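/- For an even integer $k$ let $S_k$ be the space of holomorphic cusp forms of weight $k$ for $\Gamma=\mathrm{SL}(2,\mathbb{Z})$, with the Petersson inner product $\langle f,g\rangle=\int_{\Gamma\backslash\mathbb{H}} f(z)\overline{g(z)}\,y^k\,\frac{dx\,dy}{y^2}$, and let $\mathcal{B}_k$ be an orthonormal basis of $S_k$. For $y>0$ let $\mu_k^+$ be the measure on $\mathbb{R}/\mathbb{Z}$ given by $$d\mu_k^+ = \frac{1}{|\mathcal{B}_k|}\sum_{f\in\mathcal{B}_k} y^k\,|f(x+iy)|^2\,dx .$$ There are absolute positive constants $A_0, Y_0, C, k_0$ such that the following holds for all real $A\ge A_0$, all real $Y\ge Y_0$, all even integers $k\ge k_0$, every orthonormal basis $\mathcal{B}_k$ of $S_k$, every $y$ with $$Y^{-1}<y<k^{1/2}(17A\log k)^{-1/2},$$ and every integrable function $\psi:\mathbb{R}/\mathbb{Z}\to\mathbb{C}$: the function $\psi$ is integrable with respect to $\mu_k^+$, and $$\left|\int_{\mathbb{R}/\mathbb{Z}}\psi\,d\mu_k^+ - \frac{3}{\pi}\int_{\mathbb{R}/\mathbb{Z}}\psi(x)\,dx\right|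 \le C\,\|\psi\|_\infty\,Y^2\,k^{-1/2}(\log k)^{1/2},$$ where $\|\psi\|_\infty$ is the essential supremum of $|\psi|$ (the bound says nothing if it is infinite). -/

import Mathlib

open MeasureTheory
open scoped MatrixGroups Modular ENNReal

noncomputable section

namespace ModularAverage

/-- The Petersson inner product `∫_X f(z) conj(g(z)) y ^ k dx dy / y ^ 2` on the cusp forms of
weight `k` for `SL(2, ℤ)`. The integral is over the standard fundamental domain `𝒟`, and the
volume on `ℍ` is the (not normalized) hyperbolic measure `dx dy / y ^ 2`. -/
def peterssonInner {k : ℤ} (f g : CuspForm 𝒮ℒ k) : ℂ :=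
  ∫ z in 𝒟, UpperHalfPlane.petersson k g f z

/-- `B` is an orthonormal basis of the space of cusp forms of weight `k` for `SL(2, ℤ)`, with
respect to the Petersson inner product. -/
structure IsOrthonormalBasis {k : ℤ} (B : Finset (CuspForm 𝒮ℒ k)) : Prop where
  norm_one : ∀ f ∈ B, peterssonInner f f = 1
  orthogonal : ∀ f ∈ B, ∀ g ∈ B, f ≠ g → peterssonInner f g = 0
  span_eq_top : Submodule.span ℂ (B : Set (CuspForm 𝒮ℒ k)) = ⊤

/-- The point `x + i y` of the upper half-plane. -/
def point (y : ℝ) (hy : 0 < y) (x : ℝ) : UpperHalfPlane :=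
  ⟨x + y * Complex.I, by simpa using hy⟩

/-- The function `x ↦ |B|⁻¹ ∑_{f ∈ B} y ^ k |f(x + i y)| ^ 2`. -/
def density {k : ℕ} (B : Finset (CuspForm 𝒮ℒ (k : ℤ))) (y : ℝ) (hy : 0 < y) (x : ℝ) : ℝ :=
  (B.card : ℝ)⁻¹ * ∑ f ∈ B, y ^ k * ‖f (point y hy x)‖ ^ 2

theorem density_periodic {k : ℕ} (B : Finset (CuspForm 𝒮ℒ (k : ℤ))) (y : ℝ) (hy : 0 < y) :
    Function.Periodic (density B y hy) 1 := by
  intro x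
  have h : point y hy (x + 1) = (1 : ℝ) +ᵥ point y hy x := by
    ext
    simp [point]
    ring
  have hf : ∀ f : CuspForm 𝒮ℒ (k : ℤ), f (point y hy (x + 1)) = f (point y hy x) := fun f => by
    rw [h]
    exact SlashInvariantForm.vAdd_apply_of_mem_strictPeriods f (point y hy x) (by simp)
  simp only [density, hf]

/-- The measure `|B|⁻¹ ∑_{f ∈ B} y ^ k |f(x + i y)| ^ 2 dx` on `ℝ / ℤ`, where `dx` is the
Lebesgue measure of total mass `1`. -/
def horizontalMeasure {k : ℕ} (B : Finset (CuspForm 𝒮ℒ (k : ℤ))) (y : ℝ) (hy : 0 < y) :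
    Measure UnitAddCircle :=
  volume.withDensity fun t => ENNReal.ofReal ((density_periodic B y hy).lift t)

end ModularAverage

end

/-!
Averaging the Bergman seed `((τ - conj z) / (2 i)) ^ (-k)` over `SL(2, ℤ)` gives a cusp form which,
by unfolding and the mean value property on the disc model, reproduces `f(z)` up to a constant.
Expanding it in an orthonormal basis writes `∑ |f(z)| ^ 2 y ^ k` as `(k - 1) / (8 π)` times a sum
over `γ` of terms of absolute value `cosh (d(z, γ z) / 2) ^ (-k)`. The elements `±1` contribute
`(k - 1) / (4 π)`, and `|B|` is close to `k / 12`, whence `3 / π`. Nontrivial upper triangular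
elements move `z` by about `1 / y`, so their contribution is exponentially small when `y` is small
compared to `(k / log k) ^ (1 / 2)`. For lower left entry `c ≠ 0` the terms need not be small at
every point, but `c ^ 2 cosh (d(z, γ z) / 2) ^ 2` grows quadratically in the deviation of
`c x - a` from its minimum; integrating over `x` modulo `1` and summing over `a` unfolds to an
integral over `ℝ` of size `k ^ (-1 / 2)`.
-/

noncomputable section

namespace ModularAverage

section MeanValue

open Metric Real Set

variable {E : Type*} [NormedAddCommGroup E]

lemma integrableOn_polarCoord_symm [NormedSpace ℝ E] {f : ℂ → E} (hf : Integrable f) :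
    IntegrableOn (fun p : ℝ × ℝ => p.1 • f (Complex.polarCoord.symm p)) polarCoord.target := by
  have hf' : Integrable fun p => f (Complex.measurableEquivRealProd.symm p) :=
    (Complex.volume_preserving_equiv_real_prod.symm _).integrable_comp_of_integrable hf
  refine ((integrableOn_image_iff_integrableOn_abs_det_fderiv_smul volume
    polarCoord.open_target.measurableSet
    (fun p _ => (hasFDerivAt_polarCoord_symm p).hasFDerivWithinAt)
    polarCoord.symm.injOn _).mp hf'.integrableOn).congr_fun (fun p hp => ?_)
    polarCoord.open_target.measurableSet
  beta_reduce
  rw [det_fderivPolarCoordSymm, abs_of_pos hp.1,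
    Complex.measurableEquivRealProd_symm_polarCoord_symm_apply]

lemma setIntegral_circleMap_eq_circleAverage [NormedSpace ℝ E] (f : ℂ → E) (c : ℂ) (r : ℝ) :
    ∫ θ in Ioo (-π) π, f (circleMap c r θ) = (2 * π) • circleAverage f c r := by
  rw [circleAverage_eq_integral_add (-π), smul_inv_smul₀ (by positivity),
    intervalIntegral.integral_comp_add_right fun θ => f (circleMap c r θ), zero_add,
    show 2 * π + -π = π by ring, intervalIntegral.integral_of_le (by linarith [pi_pos]),
    integral_Ioc_eq_integral_Ioo]

theorem setIntegral_ball_zero_eq_integral_circleAverage [NormedSpace ℝ E] {f : ℂ → E} {R : ℝ}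
    (hf : IntegrableOn f (ball 0 R)) :
    ∫ ζ in ball 0 R, f ζ = ∫ r in Ioo 0 R, (2 * π * r) • circleAverage f 0 r := by
  have hpolar (p : ℝ × ℝ) : Complex.polarCoord.symm p = circleMap 0 p.1 p.2 := by
    simp [circleMap, Complex.exp_mul_I]
  have hint := integrableOn_polarCoord_symm (hf.integrable_indicator measurableSet_ball)
  rw [← integral_indicator measurableSet_ball, ← Complex.integral_comp_polarCoord_symm]
  simp only [hpolar] at hint ⊢
  rw [polarCoord_target, Measure.volume_eq_prod] at hint ⊢
  rw [setIntegral_prod _ hint, ← Ioi_inter_Iio (a := 0), ← setIntegral_indicator measurableSet_Iio]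
  refine setIntegral_congr_fun measurableSet_Ioi fun r (hr : 0 < r) => ?_
  simp only [integral_smul, setIntegral_circleMap_eq_circleAverage]
  by_cases hrR : r < R
  · rw [indicator_of_mem (mem_Iio.mpr hrR), smul_smul, mul_comm r]
    congr 1
    refine circleAverage_congr_sphere fun ζ hζ => indicator_of_mem ?_ f
    rw [mem_sphere_zero_iff_norm, abs_of_pos hr] at hζ
    rwa [mem_ball_zero_iff, hζ]
  · rw [indicator_of_notMem (by simpa using hrR),
      circleAverage_congr_sphere (f₂ := fun _ => 0) fun ζ hζ => indicator_of_notMem ?_ f]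
    · simp [circleAverage_def]
    · rw [mem_sphere_zero_iff_norm, abs_of_pos hr] at hζ
      rwa [mem_ball_zero_iff, hζ]

theorem setIntegral_ball_zero_radial_smul [NormedSpace ℂ E] [CompleteSpace E] {g : ℂ → E}
    {w : ℝ → ℝ} {R : ℝ} (hg : DifferentiableOn ℂ g (ball 0 R))
    (hint : IntegrableOn (fun ζ => w ‖ζ‖ • g ζ) (ball 0 R)) :
    ∫ ζ in ball 0 R, w ‖ζ‖ • g ζ = (2 * π * ∫ r in Ioo 0 R, r * w r) • g 0 := by
  rw [setIntegral_ball_zero_eq_integral_circleAverage hint, ← integral_const_mul,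
    ← integral_smul_const]
  refine setIntegral_congr_fun measurableSet_Ioo fun r hr => ?_
  have hdiff : DiffContOnCl ℂ g (ball 0 |r|) := by
    rw [abs_of_pos hr.1]
    exact (hg.mono (closedBall_subset_ball hr.2)).diffContOnCl_ball subset_rfl
  have hradial : circleAverage (fun ζ => w ‖ζ‖ • g ζ) 0 r = w r • circleAverage g 0 r := by
    rw [← circleAverage_fun_smul]
    refine circleAverage_congr_sphere fun ζ hζ => ?_
    rw [mem_sphere_zero_iff_norm, abs_of_pos hr.1] at hζ
    simp only [hζ]
  simp only [hradial, hdiff.circleAverage, smul_smul, mul_assoc]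

lemma integral_mul_one_sub_sq_pow (m : ℕ) :
    ∫ r in Ioo (0 : ℝ) 1, r * (1 - r ^ 2) ^ m = 1 / (2 * (m + 1 : ℝ)) := by
  have hderiv (r : ℝ) : HasDerivAt (fun r : ℝ => -((1 - r ^ 2) ^ (m + 1)) / (2 * (m + 1)))
      (r * (1 - r ^ 2) ^ m) r := by
    have h : HasDerivAt (fun r : ℝ => 1 - r ^ 2) (-(2 * r)) r := by
      simpa using (hasDerivAt_pow 2 r).const_sub 1
    refine ((h.fun_pow (m + 1)).fun_neg.div_const (2 * (m + 1 : ℝ))).congr_deriv ?_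
    push_cast
    field_simp
  rw [← integral_Ioc_eq_integral_Ioo, ← intervalIntegral.integral_of_le zero_le_one,
    intervalIntegral.integral_eq_sub_of_hasDerivAt (fun r _ => hderiv r)
      ((by fun_prop : Continuous fun r : ℝ => r * (1 - r ^ 2) ^ m).intervalIntegrable _ _)]
  simp only [one_pow, sub_self, ne_eq, Nat.add_eq_zero_iff, one_ne_zero, and_false,
    not_false_eq_true, zero_pow, neg_zero, zero_div, OfNat.ofNat_ne_zero, sub_zero, zero_sub]
  field_simp

end MeanValue

section DiscModel

open Metric Set UpperHalfPlane
open scoped ComplexConjugate Manifold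

section HyperbolicMeasure

variable {E : Type*} [NormedAddCommGroup E] [NormedSpace ℝ E]

lemma measurable_inv_im_sq :
    Measurable fun z : ℍ => (1 / NNReal.mk z.im z.im_pos.le : NNReal) ^ 2 := by
  refine Continuous.measurable (.pow (.div₀ continuous_const ?_ ?_) _)
  · exact continuous_im.subtype_mk _
  · exact fun z => NNReal.ne_iff.mp z.im_ne_zero

theorem integral_eq_setIntegral_upperHalfPlaneSet (F : ℍ → E) :
    ∫ τ, F τ = ∫ w in upperHalfPlaneSet, ((1 / w.im) ^ 2) • F (ofComplex w) := by
  rw [volume_def, integral_withDensity_eq_integral_smul measurable_inv_im_sq,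
    ← range_coe, ← measurableEmbedding_coe.map_comap,
    measurableEmbedding_coe.integral_map]
  refine integral_congr_ae (.of_forall fun τ => ?_)
  simp only [ofComplex_apply, NNReal.smul_def]
  rfl

theorem integrable_iff_integrableOn_upperHalfPlaneSet (F : ℍ → E) :
    Integrable F ↔
      IntegrableOn (fun w : ℂ => ((1 / w.im) ^ 2) • F (ofComplex w)) upperHalfPlaneSet := by
  rw [volume_def, integrable_withDensity_iff_integrable_smul measurable_inv_im_sq,
    ← range_coe, IntegrableOn, ← measurableEmbedding_coe.map_comap,
    measurableEmbedding_coe.integrable_map_iff]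
  refine integrable_congr (.of_forall fun τ => ?_)
  simp only [Function.comp, ofComplex_apply, NNReal.smul_def]
  rfl

end HyperbolicMeasure

/-- The biholomorphic map from the unit disc onto the upper half-plane that sends `0` to `z`; its
values outside the unit disc are irrelevant. -/
def cayley (z : ℍ) (s : ℂ) : ℂ := (z - conj (z : ℂ) * s) / (1 - s)

lemma cayley_zero (z : ℍ) : cayley z 0 = z := by simp [cayley]

lemma one_sub_ne_zero_of_mem_ball {s : ℂ} (hs : s ∈ ball (0 : ℂ) 1) : 1 - s ≠ 0 := by
  intro h
  rw [← sub_eq_zero.mp h] at hs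
  simp at hs

lemma one_sub_norm_sq_pos {s : ℂ} (hs : s ∈ ball (0 : ℂ) 1) : 0 < 1 - ‖s‖ ^ 2 := by
  rw [mem_ball_zero_iff] at hs
  nlinarith [norm_nonneg s]

lemma coe_sub_conj (z : ℍ) : (z : ℂ) - conj (z : ℂ) = 2 * z.im * Complex.I := by
  simp [Complex.sub_conj]

lemma cayley_sub_conj (z : ℍ) {s : ℂ} (hs : s ∈ ball (0 : ℂ) 1) :
    cayley z s - conj (z : ℂ) = 2 * z.im * Complex.I / (1 - s) := by
  have h := one_sub_ne_zero_of_mem_ball hs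
  rw [cayley, ← coe_sub_conj]
  field_simp
  ring

lemma im_cayley (z : ℍ) {s : ℂ} (hs : s ∈ ball (0 : ℂ) 1) :
    (cayley z s).im = z.im * (1 - ‖s‖ ^ 2) / ‖1 - s‖ ^ 2 := by
  have h : Complex.normSq (1 - s) ≠ 0 := by simpa using one_sub_ne_zero_of_mem_ball hs
  rw [cayley, Complex.div_im, ← Complex.normSq_eq_norm_sq, ← Complex.normSq_eq_norm_sq]
  field_simp
  simp only [Complex.sub_im, coe_im, Complex.mul_im, Complex.conj_re, coe_re, Complex.conj_im,
    neg_mul, Complex.sub_re, Complex.one_re, Complex.mul_re, sub_neg_eq_add, Complex.one_im,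
    zero_sub, mul_neg, Complex.normSq_apply]
  ring

lemma im_cayley_pos (z : ℍ) {s : ℂ} (hs : s ∈ ball (0 : ℂ) 1) : 0 < (cayley z s).im := by
  rw [im_cayley z hs]
  exact div_pos (mul_pos z.im_pos (one_sub_norm_sq_pos hs))
    (pow_pos (norm_pos_iff.mpr (one_sub_ne_zero_of_mem_ball hs)) 2)

lemma injOn_cayley (z : ℍ) : InjOn (cayley z) (ball 0 1) := by
  intro s hs t ht h
  have heq := cayley_sub_conj z hs
  rw [h, cayley_sub_conj z ht] at heq
  have hs' := one_sub_ne_zero_of_mem_ball hs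
  have ht' := one_sub_ne_zero_of_mem_ball ht
  have hz : (z.im : ℂ) ≠ 0 := by exact_mod_cast z.im_ne_zero
  have hI := Complex.I_ne_zero
  field_simp at heq
  linear_combination -heq

lemma image_cayley_ball (z : ℍ) : cayley z '' ball 0 1 = upperHalfPlaneSet := by
  refine Subset.antisymm (image_subset_iff.mpr fun s hs => im_cayley_pos z hs) fun w hw => ?_
  have hw : 0 < w.im := hw
  have hne : w - conj (z : ℂ) ≠ 0 := fun h => by
    have him := congrArg Complex.im h
    simp only [Complex.sub_im, Complex.conj_im, coe_im, Complex.zero_im] at him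
    linarith [z.im_pos]
  have hzc : (z : ℂ) - conj (z : ℂ) ≠ 0 := by simpa [coe_sub_conj] using z.im_ne_zero
  refine ⟨(w - z) / (w - conj (z : ℂ)), ?_, ?_⟩
  · rw [mem_ball_zero_iff, norm_div, div_lt_one (norm_pos_iff.mpr hne),
      ← sq_lt_sq₀ (norm_nonneg _) (norm_nonneg _), ← Complex.normSq_eq_norm_sq,
      ← Complex.normSq_eq_norm_sq]
    simp only [Complex.normSq_apply, Complex.sub_re, Complex.sub_im, Complex.conj_re,
      Complex.conj_im, coe_re, coe_im]
    nlinarith [mul_pos z.im_pos hw]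
  · have hone_sub : 1 - (w - z) / (w - conj (z : ℂ)) = (z - conj (z : ℂ)) / (w - conj (z : ℂ)) := by
      field_simp
      ring
    rw [cayley, hone_sub, div_eq_iff (div_ne_zero hzc hne)]
    field_simp
    ring

lemma hasDerivAt_cayley (z : ℍ) {s : ℂ} (hs : s ∈ ball (0 : ℂ) 1) :
    HasDerivAt (cayley z) (2 * z.im * Complex.I / (1 - s) ^ 2) s := by
  have hnum : HasDerivAt (fun s : ℂ => (z : ℂ) - conj (z : ℂ) * s) (-conj (z : ℂ)) s := by
    simpa using ((hasDerivAt_id s).const_mul (conj (z : ℂ))).const_sub (z : ℂ)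
  have hden : HasDerivAt (fun s : ℂ => 1 - s) (-1) s := (hasDerivAt_id s).const_sub 1
  refine (hnum.fun_div hden (one_sub_ne_zero_of_mem_ball hs)).congr_deriv ?_
  rw [← coe_sub_conj]
  ring

/-- The real derivative of `cayley z` at a point `s` of the unit disc. -/
def cayleyFDeriv (z : ℍ) (s : ℂ) : ℂ →L[ℝ] ℂ :=
  (ContinuousLinearMap.toSpanSingleton ℂ (2 * z.im * Complex.I / (1 - s) ^ 2)).restrictScalars ℝ

lemma hasFDerivWithinAt_cayley (z : ℍ) {s : ℂ} (hs : s ∈ ball (0 : ℂ) 1) :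
    HasFDerivWithinAt (cayley z) (cayleyFDeriv z s) (ball 0 1) s :=
  ((hasDerivAt_cayley z hs).hasFDerivAt.restrictScalars ℝ).hasFDerivWithinAt

lemma abs_det_cayleyFDeriv_mul_inv_im_sq (z : ℍ) {s : ℂ} (hs : s ∈ ball (0 : ℂ) 1) :
    |(cayleyFDeriv z s).det| * (1 / (cayley z s).im) ^ 2 = 4 / (1 - ‖s‖ ^ 2) ^ 2 := by
  have hdet : |(cayleyFDeriv z s).det| = 4 * z.im ^ 2 / ‖1 - s‖ ^ 4 := by
    have hdet : (cayleyFDeriv z s).det = ‖2 * z.im * Complex.I / (1 - s) ^ 2‖ ^ 2 := by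
      simp [cayleyFDeriv, ContinuousLinearMap.det, LinearMap.det_restrictScalars,
        Algebra.norm_complex_eq, Complex.normSq_eq_norm_sq, div_pow, -map_pow]
    have hnum : ‖2 * z.im * Complex.I‖ = 2 * z.im := by simp [abs_of_pos z.im_pos]
    rw [hdet, abs_sq, norm_div, norm_pow, hnum]
    ring
  have hnorm := norm_ne_zero_iff.mpr (one_sub_ne_zero_of_mem_ball hs)
  have hball := (one_sub_norm_sq_pos hs).ne'
  have hz := z.im_ne_zero
  rw [hdet, im_cayley z hs]
  field_simp

variable {E : Type*} [NormedAddCommGroup E] [NormedSpace ℝ E]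

theorem integral_eq_setIntegral_disc (z : ℍ) (F : ℍ → E) :
    ∫ τ, F τ = ∫ s in ball 0 1, (4 / (1 - ‖s‖ ^ 2) ^ 2) • F (ofComplex (cayley z s)) := by
  rw [integral_eq_setIntegral_upperHalfPlaneSet, ← image_cayley_ball z,
    integral_image_eq_integral_abs_det_fderiv_smul volume measurableSet_ball
      (fun s hs => hasFDerivWithinAt_cayley z hs) (injOn_cayley z)]
  refine setIntegral_congr_fun measurableSet_ball fun s hs => ?_
  simp only [smul_smul, abs_det_cayleyFDeriv_mul_inv_im_sq z hs]

theorem integrable_iff_integrableOn_disc (z : ℍ) (F : ℍ → E) :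
    Integrable F ↔ IntegrableOn
      (fun s => (4 / (1 - ‖s‖ ^ 2) ^ 2) • F (ofComplex (cayley z s))) (ball 0 1) := by
  rw [integrable_iff_integrableOn_upperHalfPlaneSet, ← image_cayley_ball z,
    integrableOn_image_iff_integrableOn_abs_det_fderiv_smul volume measurableSet_ball
      (fun s hs => hasFDerivWithinAt_cayley z hs) (injOn_cayley z)]
  refine integrableOn_congr_fun (fun s hs => ?_) measurableSet_ball
  simp only [smul_smul, abs_det_cayleyFDeriv_mul_inv_im_sq z hs]

/-- The function `τ ↦ (τ - z̄) ^ (-k)`, whose Petersson pairing with a form of weight `k`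
evaluates that form at `z`. -/
def bergmanSeed (k : ℕ) (z τ : ℍ) : ℂ := (((τ : ℂ) - conj (z : ℂ)) ^ k)⁻¹

/-- The pullback of a form of weight `k` to the unit disc along `cayley z`, without the constant
factor of the automorphy factor. -/
def discPullback (k : ℕ) (z : ℍ) (f : ℍ → ℂ) (s : ℂ) : ℂ :=
  f (ofComplex (cayley z s)) * ((1 - s) ^ k)⁻¹

lemma discPullback_zero (k : ℕ) (z : ℍ) (f : ℍ → ℂ) : discPullback k z f 0 = f z := by
  simp [discPullback, cayley_zero]

lemma differentiableOn_discPullback (k : ℕ) (z : ℍ) {f : ℍ → ℂ} (hf : MDiff f) :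
    DifferentiableOn ℂ (discPullback k z f) (ball 0 1) := by
  refine DifferentiableOn.mul ?_ ?_
  · exact (UpperHalfPlane.mdifferentiable_iff.mp hf).comp
      (fun s hs => (hasDerivAt_cayley z hs).differentiableAt.differentiableWithinAt)
      (fun s hs => im_cayley_pos z hs)
  · exact DifferentiableOn.inv (by fun_prop)
      fun s hs => pow_ne_zero _ (one_sub_ne_zero_of_mem_ball hs)

lemma coe_ofComplex_cayley (z : ℍ) {s : ℂ} (hs : s ∈ ball (0 : ℂ) 1) :
    (ofComplex (cayley z s) : ℂ) = cayley z s := by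
  rw [ofComplex_apply_of_im_pos (im_cayley_pos z hs)]

lemma im_ofComplex_cayley (z : ℍ) {s : ℂ} (hs : s ∈ ball (0 : ℂ) 1) :
    (ofComplex (cayley z s)).im = z.im * (1 - ‖s‖ ^ 2) / ‖1 - s‖ ^ 2 := by
  rw [← coe_im, coe_ofComplex_cayley z hs, im_cayley z hs]

lemma norm_discPullback_sq_mul (k : ℕ) (z : ℍ) (f : ℍ → ℂ) {s : ℂ} (hs : s ∈ ball (0 : ℂ) 1) :
    ‖discPullback k z f s‖ ^ 2 * (1 - ‖s‖ ^ 2) ^ k * z.im ^ k =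
      ‖f (ofComplex (cayley z s))‖ ^ 2 * (ofComplex (cayley z s)).im ^ k := by
  have hnorm := norm_ne_zero_iff.mpr (one_sub_ne_zero_of_mem_ball hs)
  rw [im_ofComplex_cayley z hs, discPullback, norm_mul, norm_inv, norm_pow, div_pow, mul_pow z.im]
  generalize ‖f _‖ = F
  field_simp
  ring

lemma petersson_bergmanSeed_cayley (k : ℕ) (z : ℍ) (f : ℍ → ℂ) {s : ℂ}
    (hs : s ∈ ball (0 : ℂ) 1) :
    petersson k (bergmanSeed k z) f (ofComplex (cayley z s)) =
      (1 - ‖s‖ ^ 2) ^ k •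
        (z.im ^ k * conj ((2 * z.im * Complex.I : ℂ) ^ k)⁻¹ * discPullback k z f s) := by
  have hs1 : 1 - s ≠ 0 := one_sub_ne_zero_of_mem_ball hs
  have hconj : conj (1 - s) ≠ 0 := (map_ne_zero _).mpr hs1
  have hnorm : (‖1 - s‖ : ℂ) ^ 2 = (1 - s) * conj (1 - s) := (Complex.mul_conj' _).symm
  rw [petersson, bergmanSeed, coe_ofComplex_cayley z hs, cayley_sub_conj z hs,
    im_ofComplex_cayley z hs, discPullback]
  push_cast [Complex.real_smul, hnorm]
  simp only [map_inv₀, map_pow, map_div₀, div_pow, mul_pow, zpow_natCast]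
  generalize conj (1 - s) = c at *
  field_simp

lemma integrand_petersson_bergmanSeed_cayley {k : ℕ} (hk : 2 ≤ k) (z : ℍ) (f : ℍ → ℂ) {s : ℂ}
    (hs : s ∈ ball (0 : ℂ) 1) :
    (4 / (1 - ‖s‖ ^ 2) ^ 2) • petersson k (bergmanSeed k z) f (ofComplex (cayley z s)) =
      (4 * z.im ^ k * conj ((2 * z.im * Complex.I : ℂ) ^ k)⁻¹) *
        ((1 - ‖s‖ ^ 2) ^ (k - 2) • discPullback k z f s) := by
  have hpos := (one_sub_norm_sq_pos hs).ne'
  have hweight : 4 / (1 - ‖s‖ ^ 2) ^ 2 * (1 - ‖s‖ ^ 2) ^ k = 4 * (1 - ‖s‖ ^ 2) ^ (k - 2) := by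
    obtain ⟨m, rfl⟩ := Nat.exists_eq_add_of_le' hk
    rw [Nat.add_sub_cancel]
    field_simp
    ring
  rw [petersson_bergmanSeed_cayley k z f hs, smul_smul, hweight]
  simp only [Complex.real_smul, Complex.ofReal_mul, Complex.ofReal_ofNat]
  ring

lemma integrableOn_weight_smul_discPullback {k : ℕ} (hk : 4 ≤ k) (z : ℍ) {f : ℍ → ℂ}
    (hf : MDiff f) {M : ℝ} (hM : ∀ τ, ‖f τ‖ ^ 2 * τ.im ^ k ≤ M) :
    IntegrableOn (fun s => (1 - ‖s‖ ^ 2) ^ (k - 2) • discPullback k z f s) (ball 0 1) := by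
  have hcont : ContinuousOn (fun s => (1 - ‖s‖ ^ 2) ^ (k - 2) • discPullback k z f s)
      (ball 0 1) :=
    (by fun_prop : Continuous fun s : ℂ => (1 - ‖s‖ ^ 2) ^ (k - 2)).continuousOn.smul
      (differentiableOn_discPullback k z hf).continuousOn
  refine .of_bound measure_ball_lt_top (hcont.aestronglyMeasurable measurableSet_ball)
    √(M / z.im ^ k) ((ae_restrict_mem measurableSet_ball).mono fun s hs => ?_)
  have hpos := one_sub_norm_sq_pos hs
  rw [norm_smul, Real.norm_of_nonneg (by positivity)]
  refine Real.le_sqrt_of_sq_le ((le_div_iff₀ (pow_pos z.im_pos k)).mpr ?_)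
  calc ((1 - ‖s‖ ^ 2) ^ (k - 2) * ‖discPullback k z f s‖) ^ 2 * z.im ^ k
      = ‖discPullback k z f s‖ ^ 2 * (1 - ‖s‖ ^ 2) ^ ((k - 2) * 2) * z.im ^ k := by ring
    _ ≤ ‖discPullback k z f s‖ ^ 2 * (1 - ‖s‖ ^ 2) ^ k * z.im ^ k := by
        have : 1 - ‖s‖ ^ 2 ≤ 1 := sub_le_self _ (by positivity)
        gcongr ?_ * ?_ * _
        exact pow_le_pow_of_le_one hpos.le this (by lia)
    _ ≤ M := (norm_discPullback_sq_mul k z f hs).trans_le (hM _)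

theorem integrable_petersson_bergmanSeed {k : ℕ} (hk : 4 ≤ k) (z : ℍ) {f : ℍ → ℂ} (hf : MDiff f)
    {M : ℝ} (hM : ∀ τ, ‖f τ‖ ^ 2 * τ.im ^ k ≤ M) :
    Integrable (petersson k (bergmanSeed k z) f) := by
  rw [integrable_iff_integrableOn_disc z, integrableOn_congr_fun
    (fun s hs => integrand_petersson_bergmanSeed_cayley (by lia) z f hs) measurableSet_ball]
  exact (integrableOn_weight_smul_discPullback hk z hf hM).const_mul _

theorem integral_petersson_bergmanSeed {k : ℕ} (hk : 4 ≤ k) (z : ℍ) {f : ℍ → ℂ} (hf : MDiff f)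
    {M : ℝ} (hM : ∀ τ, ‖f τ‖ ^ 2 * τ.im ^ k ≤ M) :
    ∫ τ, petersson k (bergmanSeed k z) f τ =
      4 * Real.pi / (k - 1) * z.im ^ k * conj ((2 * z.im * Complex.I : ℂ) ^ k)⁻¹ * f z := by
  rw [integral_eq_setIntegral_disc z, setIntegral_congr_fun measurableSet_ball
      fun s hs => integrand_petersson_bergmanSeed_cayley (by lia) z f hs, integral_const_mul,
    setIntegral_ball_zero_radial_smul (w := fun r => (1 - r ^ 2) ^ (k - 2))
      (differentiableOn_discPullback k z hf) (integrableOn_weight_smul_discPullback hk z hf hM),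
    integral_mul_one_sub_sq_pow, discPullback_zero, Complex.real_smul]
  push_cast [Nat.cast_sub (show 2 ≤ k by lia)]
  rw [show (k : ℂ) - 2 + 1 = k - 1 by ring, one_div, mul_inv]
  ring

end DiscModel

section Unfolding

open Metric Set UpperHalfPlane

instance : Countable SL(2, ℤ) :=
  have : Countable (Matrix (Fin 2) (Fin 2) ℤ) := inferInstanceAs (Countable (Fin 2 → Fin 2 → ℤ))
  Subtype.countable

lemma ne_neg_self (γ : SL(2, ℤ)) : γ ≠ -γ := by
  intro h
  rw [← neg_one_mul, right_eq_mul] at h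
  exact absurd h (by decide)

lemma measurableEmbedding_SL2Z_smul (γ : SL(2, ℤ)) :
    MeasurableEmbedding (fun τ : ℍ => γ • τ) :=
  measurableEmbedding_const_smul (γ : GL (Fin 2) ℝ)

lemma measurePreserving_SL2Z_smul (γ : SL(2, ℤ)) :
    MeasurePreserving (fun τ : ℍ => γ • τ) volume volume :=
  measurePreserving_smul (γ : GL (Fin 2) ℝ) volume

lemma volume_setOf_re_eq (a : ℝ) : volume {w : ℂ | w.re = a} = 0 := by
  rw [← Complex.frontier_setOfPred_re_le]
  exact (convex_halfSpace_re_le a).addHaar_frontier volume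

lemma volume_fd_diff_fdo : volume (𝒟 \ 𝒟ᵒ : Set ℍ) = 0 := by
  rw [volume_eq_lintegral]
  refine setLIntegral_measure_zero _ _ (measure_mono_null
    (t := {w : ℂ | w.re = 1 / 2} ∪ {w : ℂ | w.re = -(1 / 2)} ∪ sphere 0 1) ?_ ?_)
  · rintro _ ⟨τ, ⟨⟨hnorm, hre⟩, hfdo⟩, rfl⟩
    by_contra h
    simp only [mem_union, mem_ofPred_eq, mem_sphere_zero_iff_norm, not_or, coe_re] at h
    obtain ⟨⟨hright, hleft⟩, hcircle⟩ := h
    refine hfdo ⟨lt_of_le_of_ne hnorm fun h => hcircle ?_, lt_of_le_of_ne hre fun h => ?_⟩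
    · rw [Complex.normSq_eq_norm_sq] at h
      exact (sq_eq_sq₀ (norm_nonneg _) zero_le_one).mp (by rw [← h, one_pow])
    · exact ((abs_eq (by norm_num)).mp h).elim hright hleft
  · rw [measure_union_null_iff, measure_union_null_iff]
    exact ⟨⟨volume_setOf_re_eq _, volume_setOf_re_eq _⟩, Measure.addHaar_sphere _ _ _⟩

lemma ae_exists_unique_up_to_sign_smul_mem_fd :
    ∀ᵐ τ : ℍ, ∃ γ : SL(2, ℤ), γ • τ ∈ 𝒟 ∧ ∀ γ' : SL(2, ℤ), γ' • τ ∈ 𝒟 → γ' = γ ∨ γ' = -γ := by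
  have hboundary : ∀ᵐ τ : ℍ, ∀ γ : SL(2, ℤ), γ • τ ∉ (𝒟 \ 𝒟ᵒ : Set ℍ) :=
    ae_all_iff.mpr fun γ => (measurePreserving_SL2Z_smul γ).quasiMeasurePreserving.ae
      (p := (· ∉ (𝒟 \ 𝒟ᵒ : Set ℍ))) (measure_eq_zero_iff_ae_notMem.mp volume_fd_diff_fdo)
  refine hboundary.mono fun τ hτ => ?_
  obtain ⟨γ, hγ⟩ := ModularGroup.exists_smul_mem_fd τ
  have hγo : γ • τ ∈ 𝒟ᵒ := by_contra fun hn => hτ γ ⟨hγ, hn⟩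
  refine ⟨γ, hγ, fun γ' hγ' => ?_⟩
  have hquot : (γ' * γ⁻¹) • (γ • τ) ∈ 𝒟 := by rwa [smul_smul, inv_mul_cancel_right]
  refine (ModularGroup.eq_one_or_neg_one_of_mem_fdo_mem_fd hγo hquot).imp
    mul_inv_eq_one.mp fun h => ?_
  rw [mul_inv_eq_iff_eq_mul.mp h, neg_one_mul]

lemma ae_tsum_indicator_fd_eq_two :
    ∀ᵐ τ : ℍ, ∑' γ : SL(2, ℤ), (𝒟 : Set ℍ).indicator (fun _ => (1 : ℝ≥0∞)) (γ⁻¹ • τ) = 2 := by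
  refine ae_exists_unique_up_to_sign_smul_mem_fd.mono fun τ ⟨γ, hγ, huniq⟩ => ?_
  rw [← (Equiv.inv SL(2, ℤ)).tsum_eq]
  simp only [Equiv.inv_apply, inv_inv]
  rw [tsum_eq_sum (s := {γ, -γ}) fun γ' hγ' => indicator_of_notMem
      (fun h => hγ' (by simpa using huniq γ' h)) _,
    Finset.sum_pair (ne_neg_self γ), ModularGroup.SL_neg_smul, indicator_of_mem hγ,
    one_add_one_eq_two]

theorem sum_map_smul_restrict_fd :
    Measure.sum (fun γ : SL(2, ℤ) => ((volume : Measure ℍ).restrict 𝒟).map (γ • ·)) =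
      (2 : ℝ≥0∞) • volume := by
  have hD : MeasurableSet (𝒟 : Set ℍ) := ModularGroup.isClosed_fd.measurableSet
  refine Measure.ext_of_lintegral _ fun G hG => ?_
  have htranslate (γ : SL(2, ℤ)) : ∫⁻ τ, G τ ∂(((volume : Measure ℍ).restrict 𝒟).map (γ • ·)) =
      ∫⁻ τ, (𝒟 : Set ℍ).indicator (fun _ => (1 : ℝ≥0∞)) (γ⁻¹ • τ) * G τ := by
    rw [(measurableEmbedding_SL2Z_smul γ).lintegral_map, ← lintegral_indicator hD,
      ← (measurePreserving_SL2Z_smul γ).lintegral_comp_emb (measurableEmbedding_SL2Z_smul γ)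
        (fun τ => (𝒟 : Set ℍ).indicator (fun _ => (1 : ℝ≥0∞)) (γ⁻¹ • τ) * G τ)]
    refine lintegral_congr fun τ => ?_
    by_cases hτ : τ ∈ (𝒟 : Set ℍ) <;> simp [hτ]
  have hmeas (γ : SL(2, ℤ)) :
      Measurable fun τ => (𝒟 : Set ℍ).indicator (fun _ => (1 : ℝ≥0∞)) (γ⁻¹ • τ) * G τ :=
    ((measurable_const.indicator hD).comp
      (measurableEmbedding_SL2Z_smul γ⁻¹).measurable).mul hG
  rw [lintegral_sum_measure, lintegral_smul_measure, smul_eq_mul, ← lintegral_const_mul _ hG]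
  simp_rw [htranslate]
  rw [← lintegral_tsum fun γ => (hmeas γ).aemeasurable]
  refine lintegral_congr_ae (ae_tsum_indicator_fd_eq_two.mono fun τ hτ => ?_)
  simp only [ENNReal.tsum_mul_right, hτ]

variable {E : Type*} [NormedAddCommGroup E] {F : ℍ → E}

lemma integrable_comp_smul (hF : Integrable F) (γ : SL(2, ℤ)) : Integrable fun τ => F (γ • τ) :=
  ((measurePreserving_SL2Z_smul γ).integrable_comp_emb (measurableEmbedding_SL2Z_smul γ)).mpr hF

variable [NormedSpace ℝ E]

lemma hasSum_integral_fd (hF : Integrable F) :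
    HasSum (fun γ : SL(2, ℤ) => ∫ τ in 𝒟, F (γ • τ)) ((2 : ℝ) • ∫ τ, F τ) := by
  have hint : Integrable F (Measure.sum
      (fun γ : SL(2, ℤ) => ((volume : Measure ℍ).restrict 𝒟).map (γ • ·))) := by
    rw [sum_map_smul_restrict_fd]
    exact hF.smul_measure (by simp)
  have hsum := hasSum_integral_measure hint
  rw [sum_map_smul_restrict_fd, integral_smul_measure] at hsum
  simp_rw [(measurableEmbedding_SL2Z_smul _).integral_map] at hsum
  simpa using hsum

theorem integral_fd_tsum (hF : Integrable F) :
    ∫ τ in 𝒟, ∑' γ : SL(2, ℤ), F (γ • τ) = (2 : ℝ) • ∫ τ, F τ := by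
  have hsum := hasSum_integral_of_summable_integral_norm
    (fun γ => (integrable_comp_smul hF γ).restrict (s := 𝒟))
    (hasSum_integral_fd hF.norm).summable
  rw [← hsum.tsum_eq, (hasSum_integral_fd hF).tsum_eq]

end Unfolding

section PoincareSeries

open Set UpperHalfPlane
open scoped ComplexConjugate Manifold ModularForm

/-- The coefficients `a - z̄ c` and `b - z̄ d` of the affine function `pairing z γ`, where
`γ = (a, b; c, d)`. -/
def pairingCoeff (z : ℍ) (γ : SL(2, ℤ)) (j : Fin 2) : ℂ := γ 0 j - conj (z : ℂ) * γ 1 j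

/-- The affine function `(a τ + b) - z̄ (c τ + d)` of `τ`, where `γ = (a, b; c, d)`. -/
def pairing (z : ℍ) (γ : SL(2, ℤ)) (τ : ℂ) : ℂ := pairingCoeff z γ 0 * τ + pairingCoeff z γ 1

lemma pairing_eq_mul_denom (z τ : ℍ) (γ : SL(2, ℤ)) :
    pairing z γ τ = ((γ • τ : ℍ) - conj (z : ℂ)) * denom γ τ := by
  have hdenom : (γ 1 0 : ℂ) * τ + γ 1 1 ≠ 0 := by
    rw [← ModularGroup.denom_apply]
    exact denom_ne_zero _ τ
  rw [ModularGroup.denom_apply, coe_specialLinearGroup_apply]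
  simp only [algebraMap_int_eq, eq_intCast, Complex.ofReal_intCast]
  rw [sub_mul, div_mul_cancel₀ _ hdenom, pairing, pairingCoeff, pairingCoeff]
  ring

lemma bergmanSeed_slash (k : ℕ) (z : ℍ) (γ : SL(2, ℤ)) (τ : ℍ) :
    (bergmanSeed k z ∣[(k : ℤ)] γ) τ = (pairing z γ τ ^ k)⁻¹ := by
  rw [ModularForm.SL_slash_apply, bergmanSeed, pairing_eq_mul_denom, zpow_neg, zpow_natCast,
    mul_pow, mul_inv]

lemma det_eq_one (γ : SL(2, ℤ)) : γ 0 0 * γ 1 1 - γ 0 1 * γ 1 0 = 1 := by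
  rw [← Matrix.det_fin_two, γ.det_coe]

lemma pairingCoeff_ne_zero (z : ℍ) (γ : SL(2, ℤ)) (j : Fin 2) : pairingCoeff z γ j ≠ 0 := by
  intro h
  have hlower : γ 1 j = 0 := by simpa [pairingCoeff, z.im_ne_zero] using congrArg Complex.im h
  have hupper : γ 0 j = 0 := by simpa [pairingCoeff, hlower] using congrArg Complex.re h
  have hdet := det_eq_one γ
  fin_cases j <;> simp_all

lemma norm_pairingCoeff (z : ℍ) (γ : SL(2, ℤ)) (j : Fin 2) :
    ‖pairingCoeff z γ j‖ = ‖((-γ 1 j : ℤ) : ℂ) * z + γ 0 j‖ := by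
  rw [← Complex.norm_conj, pairingCoeff]
  congr 1
  simp only [map_sub, map_intCast, map_mul, Complex.conj_conj, Int.cast_neg, neg_mul]
  ring

lemma norm_pairingCoeff_zero_mul_im_le (z τ : ℍ) (γ : SL(2, ℤ)) :
    ‖pairingCoeff z γ 0‖ * τ.im ≤ ‖pairing z γ τ‖ := by
  have hdet : (γ 0 0 * γ 1 1 - γ 0 1 * γ 1 0 : ℝ) = 1 := by exact_mod_cast det_eq_one γ
  have him : (pairing z γ τ * conj (pairingCoeff z γ 0)).im =
      ‖pairingCoeff z γ 0‖ ^ 2 * τ.im + z.im := by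
    rw [← Complex.normSq_eq_norm_sq]
    simp only [pairing, pairingCoeff, Complex.mul_im, Complex.add_re, Complex.mul_re,
      Complex.sub_re, Complex.intCast_re, Complex.conj_re, coe_re, Complex.conj_im, coe_im,
      Complex.intCast_im, mul_zero, sub_zero, Complex.sub_im, neg_mul, zero_add, sub_neg_eq_add,
      mul_neg, Complex.add_im, Complex.normSq_apply, map_sub, map_mul, map_intCast]
    linear_combination z.im * hdet
  refine le_of_mul_le_mul_left ?_ (norm_pos_iff.mpr (pairingCoeff_ne_zero z γ 0))
  calc ‖pairingCoeff z γ 0‖ * (‖pairingCoeff z γ 0‖ * τ.im)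
      ≤ (pairing z γ τ * conj (pairingCoeff z γ 0)).im := by rw [him]; linarith [z.im_pos]
    _ ≤ ‖pairing z γ τ * conj (pairingCoeff z γ 0)‖ :=
        (le_abs_self _).trans (Complex.abs_im_le_norm _)
    _ = ‖pairingCoeff z γ 0‖ * ‖pairing z γ τ‖ := by rw [norm_mul, Complex.norm_conj, mul_comm]

lemma pairing_ne_zero (z τ : ℍ) (γ : SL(2, ℤ)) : pairing z γ τ ≠ 0 :=
  norm_pos_iff.mp <|
    (mul_pos (norm_pos_iff.mpr (pairingCoeff_ne_zero z γ 0)) τ.im_pos).trans_le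
      (norm_pairingCoeff_zero_mul_im_le z τ γ)

lemma norm_pairingCoeff_mul_norm_pairingCoeff_le (z τ : ℍ) (γ : SL(2, ℤ)) :
    ‖pairingCoeff z γ 0‖ * ‖pairingCoeff z γ 1‖ * τ.im ^ 2 ≤
      ‖pairing z γ τ‖ ^ 2 * (τ.im + ‖(τ : ℂ)‖) := by
  have hslope := norm_pairingCoeff_zero_mul_im_le z τ γ
  have hconst : ‖pairingCoeff z γ 1‖ ≤
      ‖pairing z γ τ‖ + ‖pairingCoeff z γ 0‖ * ‖(τ : ℂ)‖ := by
    rw [← norm_mul, show pairingCoeff z γ 1 = pairing z γ τ - pairingCoeff z γ 0 * τ by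
      rw [pairing]; ring]
    exact norm_sub_le _ _
  have := τ.im_pos
  calc ‖pairingCoeff z γ 0‖ * ‖pairingCoeff z γ 1‖ * τ.im ^ 2
      = (‖pairingCoeff z γ 0‖ * τ.im) * (‖pairingCoeff z γ 1‖ * τ.im) := by ring
    _ ≤ ‖pairing z γ τ‖ * ((‖pairing z γ τ‖ + ‖pairingCoeff z γ 0‖ * ‖(τ : ℂ)‖) * τ.im) := by
        gcongr
    _ = ‖pairing z γ τ‖ *
          (‖pairing z γ τ‖ * τ.im + (‖pairingCoeff z γ 0‖ * τ.im) * ‖(τ : ℂ)‖) := by ring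
    _ ≤ ‖pairing z γ τ‖ * (‖pairing z γ τ‖ * τ.im + ‖pairing z γ τ‖ * ‖(τ : ℂ)‖) := by gcongr
    _ = ‖pairing z γ τ‖ ^ 2 * (τ.im + ‖(τ : ℂ)‖) := by ring

/-- A majorant of the terms of the Poincaré series of weight `2 * m` that is summable over `γ`, up
to a factor depending on `τ` only. -/
def majorant (m : ℕ) (z : ℍ) (γ : SL(2, ℤ)) : ℝ :=
  ((‖pairingCoeff z γ 0‖ * ‖pairingCoeff z γ 1‖) ^ m)⁻¹

lemma majorant_nonneg (m : ℕ) (z : ℍ) (γ : SL(2, ℤ)) : 0 ≤ majorant m z γ := by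
  unfold majorant
  positivity

/-- The majorant is a product of two terms of Eisenstein series of weight `m`. -/
lemma summable_majorant {m : ℕ} (hm : 3 ≤ m) (z : ℍ) : Summable (majorant m z) := by
  have hEis := EisensteinSeries.summable_norm_eisSummand (k := m) (by exact_mod_cast hm) z
  have hprod := hEis.mul_of_nonneg hEis (fun _ => norm_nonneg _) (fun _ => norm_nonneg _)
  have hinj : Function.Injective (fun γ : SL(2, ℤ) =>
      ((![-γ 1 0, γ 0 0] : Fin 2 → ℤ), (![-γ 1 1, γ 0 1] : Fin 2 → ℤ))) := by
    intro γ γ' h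
    simp only [Prod.mk.injEq, Matrix.vecCons_inj, neg_inj, and_true] at h
    obtain ⟨⟨hc, ha⟩, hd, hb⟩ := h
    ext i j
    fin_cases i <;> fin_cases j <;> assumption
  refine (hprod.comp_injective hinj).congr fun γ => ?_
  simp [majorant, norm_pairingCoeff, EisensteinSeries.eisSummand, mul_pow, mul_comm]

lemma norm_inv_pairing_pow_le (m : ℕ) (z τ : ℍ) (γ : SL(2, ℤ)) :
    ‖(pairing z γ τ ^ (2 * m))⁻¹‖ ≤
      ((τ.im + ‖(τ : ℂ)‖) / τ.im ^ 2) ^ m * majorant m z γ := by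
  have := τ.im_pos
  have hcoeff : 0 < ‖pairingCoeff z γ 0‖ * ‖pairingCoeff z γ 1‖ :=
    mul_pos (norm_pos_iff.mpr (pairingCoeff_ne_zero z γ 0))
      (norm_pos_iff.mpr (pairingCoeff_ne_zero z γ 1))
  have hpairing := norm_pos_iff.mpr (pairing_ne_zero z τ γ)
  have hsq : (‖pairing z γ τ‖ ^ 2)⁻¹ ≤
      (τ.im + ‖(τ : ℂ)‖) / τ.im ^ 2 * (‖pairingCoeff z γ 0‖ * ‖pairingCoeff z γ 1‖)⁻¹ := by
    rw [← div_eq_mul_inv, div_div, inv_eq_one_div,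
      div_le_div_iff₀ (by positivity) (by positivity)]
    linarith [norm_pairingCoeff_mul_norm_pairingCoeff_le z τ γ]
  calc ‖(pairing z γ τ ^ (2 * m))⁻¹‖ = ((‖pairing z γ τ‖ ^ 2)⁻¹) ^ m := by
        rw [norm_inv, norm_pow, pow_mul, inv_pow]
    _ ≤ _ := pow_le_pow_left₀ (by positivity) hsq m
    _ = _ := by rw [mul_pow, inv_pow, majorant]

/-- The Poincaré series with seed `bergmanSeed k z`, which is the Bergman kernel for weight `k` up
to a constant. -/
def poincareSeries (k : ℕ) (z τ : ℍ) : ℂ := ∑' γ : SL(2, ℤ), (bergmanSeed k z ∣[(k : ℤ)] γ) τ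

lemma poincareSeries_eq_tsum_pairing (k : ℕ) (z τ : ℍ) :
    poincareSeries k z τ = ∑' γ : SL(2, ℤ), (pairing z γ τ ^ k)⁻¹ := by
  simp_rw [poincareSeries, bergmanSeed_slash]

lemma poincareSeries_slash (k : ℕ) (z : ℍ) (γ : SL(2, ℤ)) :
    poincareSeries k z ∣[(k : ℤ)] γ = poincareSeries k z := by
  ext τ
  rw [ModularForm.SL_slash_apply, poincareSeries, poincareSeries, ← tsum_mul_right]
  conv_rhs => rw [← (Equiv.mulRight γ).tsum_eq]
  refine tsum_congr fun δ => ?_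
  rw [Equiv.coe_mulRight, SlashAction.slash_mul, ModularForm.SL_slash_apply (_ ∣[(k : ℤ)] δ)]

/-- The Poincaré series with seed `bergmanSeed k z` as a slash invariant form. -/
def poincareSlashInvariantForm (k : ℕ) (z : ℍ) : SlashInvariantForm 𝒮ℒ (k : ℤ) where
  toFun := poincareSeries k z
  slash_action_eq' := by
    rintro _ ⟨γ, rfl⟩
    exact poincareSeries_slash k z γ

lemma poincareSeries_intCast_vadd (k : ℕ) (z τ : ℍ) (n : ℤ) :
    poincareSeries k z ((n : ℝ) +ᵥ τ) = poincareSeries k z τ :=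
  SlashInvariantForm.vAdd_apply_of_mem_strictPeriods (poincareSlashInvariantForm k z) τ <| by
    rw [Subgroup.strictPeriods_SL2Z, AddSubgroup.mem_zmultiples_iff]
    exact ⟨n, by simp⟩

variable {m : ℕ}

lemma summable_inv_pairing_pow (hm : 3 ≤ m) (z τ : ℍ) :
    Summable fun γ : SL(2, ℤ) => (pairing z γ τ ^ (2 * m))⁻¹ :=
  .of_norm_bounded ((summable_majorant hm z).mul_left _) (norm_inv_pairing_pow_le m z τ)

lemma differentiableOn_tsum_inv_pairing_pow (hm : 3 ≤ m) (z : ℍ) :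
    DifferentiableOn ℂ (fun w : ℂ => ∑' γ : SL(2, ℤ), (pairing z γ w ^ (2 * m))⁻¹)
      upperHalfPlaneSet := by
  intro w₀ (hw₀ : 0 < w₀.im)
  let U : Set ℂ := {w | w₀.im / 2 < w.im} ∩ {w | w.im + ‖w‖ < w₀.im + ‖w₀‖ + 1}
  have hU : IsOpen U := (isOpen_lt (by fun_prop) (by fun_prop)).inter
    (isOpen_lt (by fun_prop) (by fun_prop))
  have hw₀U : w₀ ∈ U := ⟨half_lt_self hw₀, by simp⟩
  have hpos {w : ℂ} (hw : w ∈ U) : 0 < w.im := (half_pos hw₀).trans hw.1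
  refine (DifferentiableOn.differentiableAt ?_ (hU.mem_nhds hw₀U)).differentiableWithinAt
  refine Complex.differentiableOn_tsum_of_summable_norm ((summable_majorant hm z).mul_left
    (((w₀.im + ‖w₀‖ + 1) / (w₀.im / 2) ^ 2) ^ m)) (fun γ => ?_) hU (fun γ w hw => ?_)
  · refine DifferentiableOn.inv ?_ fun w hw => pow_ne_zero _ (pairing_ne_zero z ⟨w, hpos hw⟩ γ)
    unfold pairing
    fun_prop
  · refine (norm_inv_pairing_pow_le m z ⟨w, hpos hw⟩ γ).trans ?_
    have := hpos hw
    gcongr ?_ ^ m * _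
    · exact majorant_nonneg m z γ
    · change (w.im + ‖w‖) / w.im ^ 2 ≤ _
      gcongr ?_ / ?_ ^ 2
      exacts [hw.2.le, hw.1.le]

lemma mdifferentiable_poincareSeries (hm : 3 ≤ m) (z : ℍ) : MDiff (poincareSeries (2 * m) z) := by
  refine UpperHalfPlane.mdifferentiable_iff.mpr
    ((differentiableOn_tsum_inv_pairing_pow hm z).congr fun w hw => ?_)
  simp only [Function.comp, poincareSeries_eq_tsum_pairing, ofComplex_apply_of_im_pos hw]

lemma norm_poincareSeries_le (hm : 3 ≤ m) (z τ : ℍ) :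
    ‖poincareSeries (2 * m) z τ‖ ≤
      ((τ.im + ‖(τ : ℂ)‖) / τ.im ^ 2) ^ m * ∑' γ, majorant m z γ := by
  rw [poincareSeries_eq_tsum_pairing, ← tsum_mul_left]
  exact tsum_of_norm_bounded ((summable_majorant hm z).mul_left _).hasSum
    (norm_inv_pairing_pow_le m z τ)

lemma norm_poincareSeries_le_div_im (hm : 3 ≤ m) (z τ : ℍ) (hτ : 3 ≤ τ.im) :
    ‖poincareSeries (2 * m) z τ‖ ≤ 3 / τ.im * ∑' γ, majorant m z γ := by
  set τ' : ℍ := ((-round τ.re : ℤ) : ℝ) +ᵥ τ with hτ'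
  have him : τ'.im = τ.im := by simp [hτ']
  have hre : |τ'.re| ≤ 1 := by
    rw [show τ'.re = τ.re - round τ.re by simp [hτ']; ring]
    linarith [abs_sub_round τ.re]
  have hnorm : ‖(τ' : ℂ)‖ ≤ 1 + τ.im := by
    refine (Complex.norm_le_abs_re_add_abs_im _).trans ?_
    rw [coe_re, coe_im, abs_of_pos τ'.im_pos, him]
    linarith
  have hquot : (τ'.im + ‖(τ' : ℂ)‖) / τ'.im ^ 2 ≤ 3 / τ.im := by
    rw [him, div_le_div_iff₀ (by positivity) (by positivity)]
    nlinarith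
  rw [← poincareSeries_intCast_vadd _ _ _ (-round τ.re)]
  refine (norm_poincareSeries_le hm z τ').trans ?_
  gcongr ?_ * _
  · exact tsum_nonneg (majorant_nonneg m z)
  · have := τ'.im_pos
    calc _ ≤ (3 / τ.im) ^ m := by gcongr
      _ ≤ 3 / τ.im := pow_le_of_le_one (by positivity)
          ((div_le_one (by positivity)).mpr hτ) (by lia)

lemma isZeroAtImInfty_poincareSeries (hm : 3 ≤ m) (z : ℍ) :
    IsZeroAtImInfty (poincareSeries (2 * m) z) := by
  rw [isZeroAtImInfty_iff]
  intro ε hε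
  set S := ∑' γ, majorant m z γ
  refine ⟨max 3 (3 * S / ε), fun τ hτ => ?_⟩
  refine (norm_poincareSeries_le_div_im hm z τ ((le_max_left _ _).trans hτ)).trans ?_
  have hτS : 3 * S / ε ≤ τ.im := (le_max_right _ _).trans hτ
  rw [div_mul_eq_mul_div, div_le_iff₀ τ.im_pos]
  linarith [(div_le_iff₀ hε).mp hτS]

/-- The Poincaré series with seed `bergmanSeed (2 * m) z` as a cusp form. -/
def poincareCuspForm (hm : 3 ≤ m) (z : ℍ) : CuspForm 𝒮ℒ ((2 * m : ℕ) : ℤ) where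
  toSlashInvariantForm := poincareSlashInvariantForm (2 * m) z
  holo' := mdifferentiable_poincareSeries hm z
  zero_at_cusps' hc := by
    rw [OnePoint.isZeroAt_iff_forall_SL2Z hc]
    intro γ _
    change IsZeroAtImInfty (poincareSeries (2 * m) z ∣[((2 * m : ℕ) : ℤ)] γ)
    rw [poincareSeries_slash]
    exact isZeroAtImInfty_poincareSeries hm z

end PoincareSeries

section ReproducingKernel

open UpperHalfPlane
open scoped ComplexConjugate Manifold ModularForm

lemma petersson_poincareCuspForm {m : ℕ} (hm : 3 ≤ m) (z τ : ℍ)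
    (f : CuspForm 𝒮ℒ ((2 * m : ℕ) : ℤ)) :
    petersson (2 * m : ℕ) (poincareCuspForm hm z) f τ =
      ∑' γ : SL(2, ℤ), petersson (2 * m : ℕ) (bergmanSeed (2 * m) z) f (γ • τ) := by
  have hslash (γ : SL(2, ℤ)) : (f : ℍ → ℂ) ∣[((2 * m : ℕ) : ℤ)] γ = f :=
    f.slash_action_eq' _ ⟨γ, rfl⟩
  have hterm (γ : SL(2, ℤ)) :
      petersson (2 * m : ℕ) (bergmanSeed (2 * m) z) f (γ • τ) =
        conj ((bergmanSeed (2 * m) z ∣[((2 * m : ℕ) : ℤ)] γ) τ) *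
          (f τ * τ.im ^ ((2 * m : ℕ) : ℤ)) := by
    rw [← petersson_slash_SL, hslash, petersson, mul_assoc]
  simp_rw [hterm, tsum_mul_right, ← Complex.conj_tsum]
  rw [petersson, mul_assoc]
  rfl

theorem peterssonInner_poincareCuspForm {m : ℕ} (hm : 3 ≤ m) (z : ℍ)
    (f : CuspForm 𝒮ℒ ((2 * m : ℕ) : ℤ)) :
    peterssonInner f (poincareCuspForm hm z) =
      8 * Real.pi / ((2 * m : ℕ) - 1) * z.im ^ (2 * m) *
        conj ((2 * z.im * Complex.I : ℂ) ^ (2 * m))⁻¹ * f z := by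
  obtain ⟨M, hM⟩ := CuspFormClass.petersson_bounded_left (2 * m : ℕ) 𝒮ℒ f f
  have hbound (τ : ℍ) : ‖f τ‖ ^ 2 * τ.im ^ (2 * m) ≤ M := by
    refine le_of_eq_of_le ?_ (hM τ)
    rw [petersson, zpow_natCast, norm_mul, norm_mul, norm_pow, Complex.norm_conj, ← sq,
      Complex.norm_of_nonneg τ.im_pos.le]
  have hk : 4 ≤ 2 * m := by lia
  have hf : MDiff (f : ℍ → ℂ) := f.holo'
  simp_rw [peterssonInner, petersson_poincareCuspForm]
  rw [integral_fd_tsum (integrable_petersson_bergmanSeed hk z hf hbound),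
    integral_petersson_bergmanSeed hk z hf hbound, Complex.real_smul]
  push_cast
  ring

section OrthonormalBasis

variable {k : ℤ} {B : Finset (CuspForm 𝒮ℒ k)}

lemma sum_smul_apply (s : Finset (CuspForm 𝒮ℒ k)) (a : CuspForm 𝒮ℒ k → ℂ) (τ : ℍ) :
    (∑ g ∈ s, a g • g) τ = ∑ g ∈ s, a g * g τ := by
  simp

lemma petersson_sum_smul (s : Finset (CuspForm 𝒮ℒ k)) (a : CuspForm 𝒮ℒ k → ℂ)
    (f : CuspForm 𝒮ℒ k) (τ : ℍ) :
    petersson k (∑ g ∈ s, a g • g : CuspForm 𝒮ℒ k) f τ =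
      ∑ g ∈ s, conj (a g) * petersson k g f τ := by
  rw [petersson, sum_smul_apply, map_sum, Finset.sum_mul, Finset.sum_mul]
  refine Finset.sum_congr rfl fun g _ => ?_
  rw [petersson, map_mul]
  ring

lemma norm_petersson_le (f g : ℍ → ℂ) (τ : ℍ) :
    ‖petersson k g f τ‖ ≤ ‖petersson k f f τ‖ + ‖petersson k g g τ‖ := by
  simp only [petersson, norm_mul, Complex.norm_conj, ← add_mul]
  gcongr
  nlinarith [sq_nonneg (‖g τ‖ - ‖f τ‖), sq_nonneg (‖g τ‖ + ‖f τ‖)]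

/-- The Bochner integral of a nonintegrable function is `0`, hence not `1`. -/
lemma IsOrthonormalBasis.integrableOn_petersson_self (hB : IsOrthonormalBasis B)
    {f : CuspForm 𝒮ℒ k} (hf : f ∈ B) : IntegrableOn (petersson k f f) 𝒟 := by
  by_contra h
  exact zero_ne_one ((integral_undef h).symm.trans (hB.norm_one f hf))

lemma IsOrthonormalBasis.integrableOn_petersson (hB : IsOrthonormalBasis B)
    {f g : CuspForm 𝒮ℒ k} (hf : f ∈ B) (hg : g ∈ B) : IntegrableOn (petersson k g f) 𝒟 :=
  .mono' ((hB.integrableOn_petersson_self hf).norm.add (hB.integrableOn_petersson_self hg).norm)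
    (petersson_continuous k (MDifferentiable.continuous g.holo')
      (MDifferentiable.continuous f.holo')).aestronglyMeasurable
    (.of_forall fun τ => norm_petersson_le f g τ)

lemma IsOrthonormalBasis.peterssonInner_sum_smul (hB : IsOrthonormalBasis B)
    (a : CuspForm 𝒮ℒ k → ℂ) {f : CuspForm 𝒮ℒ k} (hf : f ∈ B) :
    peterssonInner f (∑ g ∈ B, a g • g) = conj (a f) := by
  have hlinear : peterssonInner f (∑ g ∈ B, a g • g) =
      ∑ g ∈ B, conj (a g) * peterssonInner f g := by
    simp_rw [peterssonInner, petersson_sum_smul]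
    rw [integral_finsetSum _ fun g hg => (hB.integrableOn_petersson hf hg).const_mul _]
    simp_rw [integral_const_mul]
  rw [hlinear, Finset.sum_eq_single_of_mem f hf fun g hg hgf => by
    rw [hB.orthogonal f hf g hg hgf.symm, mul_zero], hB.norm_one f hf, mul_one]

lemma IsOrthonormalBasis.apply_eq_sum (hB : IsOrthonormalBasis B) (g : CuspForm 𝒮ℒ k) (z : ℍ) :
    g z = ∑ f ∈ B, conj (peterssonInner f g) * f z := by
  have hg : g ∈ Submodule.span ℂ (B : Set (CuspForm 𝒮ℒ k)) := hB.span_eq_top ▸ trivial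
  obtain ⟨a, -, rfl⟩ := Submodule.mem_span_finset.mp hg
  rw [sum_smul_apply]
  refine Finset.sum_congr rfl fun f hf => ?_
  rw [hB.peterssonInner_sum_smul a hf, Complex.conj_conj]

lemma IsOrthonormalBasis.linearIndepOn (hB : IsOrthonormalBasis B) :
    LinearIndepOn ℂ id (B : Set (CuspForm 𝒮ℒ k)) := by
  rw [linearIndepOn_finset_iff]
  intro a ha f hf
  have hzero : peterssonInner f (0 : CuspForm 𝒮ℒ k) = 0 := by simp [peterssonInner, petersson]
  simp only [id_eq] at ha
  simpa [ha, hzero] using (hB.peterssonInner_sum_smul a hf).symm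

lemma IsOrthonormalBasis.finrank_eq_card (hB : IsOrthonormalBasis B) :
    Module.finrank ℂ (CuspForm 𝒮ℒ k) = B.card := by
  rw [← finrank_top ℂ (CuspForm 𝒮ℒ k), ← hB.span_eq_top,
    finrank_span_finset_eq_card hB.linearIndepOn]

end OrthonormalBasis

variable {m : ℕ} {B : Finset (CuspForm 𝒮ℒ ((2 * m : ℕ) : ℤ))}

lemma IsOrthonormalBasis.poincareSeries_apply_self (hB : IsOrthonormalBasis B) (hm : 3 ≤ m)
    (z : ℍ) :
    poincareSeries (2 * m) z z =
      8 * Real.pi / ((2 * m : ℕ) - 1) * ((2 * z.im * Complex.I : ℂ) ^ (2 * m))⁻¹ *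
        (∑ f ∈ B, z.im ^ (2 * m) * ‖f z‖ ^ 2 : ℝ) := by
  refine (hB.apply_eq_sum (poincareCuspForm hm z) z).trans ?_
  rw [Complex.ofReal_sum, Finset.mul_sum]
  refine Finset.sum_congr rfl fun f _ => ?_
  have hnorm : ((‖f z‖ ^ 2 : ℝ) : ℂ) = conj (f z) * f z := by
    rw [← Complex.normSq_eq_norm_sq, Complex.normSq_eq_conj_mul_self]
  rw [peterssonInner_poincareCuspForm, Complex.ofReal_mul, hnorm]
  simp only [map_mul, map_div₀, map_sub, map_natCast, map_one, map_ofNat, map_pow,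
    Complex.conj_ofReal, Complex.conj_conj, Complex.ofReal_pow]
  ring

theorem IsOrthonormalBasis.sum_eq_tsum_pairing (hB : IsOrthonormalBasis B) (hm : 3 ≤ m) (z : ℍ) :
    ((∑ f ∈ B, z.im ^ (2 * m) * ‖f z‖ ^ 2 : ℝ) : ℂ) =
      ((2 * m : ℕ) - 1) / (8 * Real.pi) *
        ∑' γ : SL(2, ℤ), ((pairing z γ z / (2 * z.im * Complex.I)) ^ (2 * m))⁻¹ := by
  have hself := hB.poincareSeries_apply_self hm z
  have hI : (2 * z.im * Complex.I : ℂ) ≠ 0 := by simp [z.im_ne_zero]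
  have hm1 : ((2 * m : ℕ) : ℂ) - 1 ≠ 0 := sub_ne_zero.mpr (by exact_mod_cast (by lia : 2 * m ≠ 1))
  have hpi : (Real.pi : ℂ) ≠ 0 := by exact_mod_cast Real.pi_ne_zero
  rw [poincareSeries_eq_tsum_pairing] at hself
  simp_rw [div_pow, inv_div, div_eq_mul_inv _ (_ ^ (2 * m)), tsum_mul_left, hself]
  field_simp

end ReproducingKernel

section HyperbolicDisplacement

open UpperHalfPlane Real

variable (z : ℍ) (γ : SL(2, ℤ))

lemma norm_pairing_div :
    ‖pairing z γ z / (2 * z.im * Complex.I)‖ = cosh (dist z (γ • z) / 2) := by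
  have hdenom : 0 < ‖denom γ z‖ := norm_pos_iff.mpr (denom_ne_zero _ z)
  have hsqrt : √((γ • z).im * z.im) = z.im / ‖denom γ z‖ := by
    rw [ModularGroup.im_smul_eq_div_normSq, Complex.normSq_eq_norm_sq, div_mul_eq_mul_div,
      ← sq, ← div_pow, sqrt_sq (by positivity)]
  rw [dist_comm, cosh_half_dist, hsqrt, pairing_eq_mul_denom, Complex.dist_eq, norm_div, norm_mul]
  simp only [Complex.norm_mul, Complex.norm_ofNat, Complex.norm_real, norm_eq_abs,
    abs_of_pos z.im_pos, Complex.norm_I, mul_one]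
  field_simp

lemma cosh_half_dist_smul_sq :
    cosh (dist z (γ • z) / 2) ^ 2 = ((γ 0 0 + γ 1 1 : ℤ) : ℝ) ^ 2 / 4 +
      ((γ 0 0 - γ 1 1 : ℤ) * z.re + γ 0 1 - γ 1 0 * (z.re ^ 2 + z.im ^ 2)) ^ 2 /
        (4 * z.im ^ 2) := by
  have hz := z.im_ne_zero
  rw [← norm_pairing_div, norm_div, div_pow, ← Complex.normSq_eq_norm_sq]
  simp only [pairing, pairingCoeff, Complex.normSq_apply, Complex.add_re, Complex.mul_re,
    Complex.sub_re, Complex.intCast_re, Complex.conj_re, coe_re, Complex.conj_im, coe_im,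
    Complex.intCast_im, mul_zero, sub_zero, Complex.sub_im, Complex.mul_im, neg_mul, zero_add,
    sub_neg_eq_add, Complex.add_im, Complex.norm_mul, Complex.norm_ofNat, Complex.norm_real,
    norm_eq_abs, Complex.norm_I, mul_one, mul_pow, sq_abs, Int.cast_add, Int.cast_sub]
  field_simp
  ring

lemma cosh_half_dist_smul_sq_of_ne_zero (hc : γ 1 0 ≠ 0) :
    cosh (dist z (γ • z) / 2) ^ 2 = ((γ 0 0 + γ 1 1 : ℤ) : ℝ) ^ 2 / 4 +
      ((γ 1 0 * z.re - (γ 0 0 - γ 1 1 : ℤ) / 2) ^ 2 + (γ 1 0 * z.im) ^ 2 + 1 -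
        ((γ 0 0 + γ 1 1 : ℤ) : ℝ) ^ 2 / 4) ^ 2 / (4 * (γ 1 0 * z.im) ^ 2) := by
  have hz := z.im_ne_zero
  have hc' : (γ 1 0 : ℝ) ≠ 0 := by exact_mod_cast hc
  have hdet : (γ 0 0 * γ 1 1 - γ 0 1 * γ 1 0 : ℝ) = 1 := by exact_mod_cast det_eq_one γ
  have hnum : (γ 1 0 * z.re - (γ 0 0 - γ 1 1 : ℤ) / 2 : ℝ) ^ 2 + (γ 1 0 * z.im) ^ 2 + 1 -
        ((γ 0 0 + γ 1 1 : ℤ) : ℝ) ^ 2 / 4 =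
      -(γ 1 0 : ℝ) * ((γ 0 0 - γ 1 1 : ℤ) * z.re + γ 0 1 -
        γ 1 0 * (z.re ^ 2 + z.im ^ 2)) := by
    push_cast
    linear_combination -hdet
  rw [cosh_half_dist_smul_sq, hnum, mul_pow, mul_pow, neg_sq]
  field_simp

lemma diag_eq_of_lowerLeft_eq_zero (hc : γ 1 0 = 0) :
    (γ 0 0 = 1 ∧ γ 1 1 = 1) ∨ (γ 0 0 = -1 ∧ γ 1 1 = -1) := by
  have hdet := det_eq_one γ
  rw [hc, mul_zero, sub_zero] at hdet
  exact Int.eq_one_or_neg_one_of_mul_eq_one' hdet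

lemma cosh_half_dist_smul_sq_of_eq_zero (hc : γ 1 0 = 0) :
    cosh (dist z (γ • z) / 2) ^ 2 = 1 + (γ 0 1 : ℝ) ^ 2 / (4 * z.im ^ 2) := by
  rw [cosh_half_dist_smul_sq, hc]
  rcases diag_eq_of_lowerLeft_eq_zero γ hc with ⟨ha, hd⟩ | ⟨ha, hd⟩ <;>
  · rw [ha, hd]
    push_cast
    ring

section RealEstimate

variable {t u s W : ℝ} {m : ℕ}

lemma sq_div_four_le_of_eq
    (hW : W = t ^ 2 / 4 + (u ^ 2 + s ^ 2 + 1 - t ^ 2 / 4) ^ 2 / (4 * s ^ 2)) : t ^ 2 / 4 ≤ W := by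
  rw [hW]
  exact le_add_of_nonneg_right (by positivity)

lemma one_add_sq_le_of_eq (hs : s ≠ 0)
    (hW : W = t ^ 2 / 4 + (u ^ 2 + s ^ 2 + 1 - t ^ 2 / 4) ^ 2 / (4 * s ^ 2)) : 1 + u ^ 2 ≤ W := by
  have : W = 1 + u ^ 2 + ((u ^ 2 + 1 - t ^ 2 / 4 - s ^ 2) / (2 * s)) ^ 2 := by
    rw [hW]
    field_simp
    ring
  linarith [sq_nonneg ((u ^ 2 + 1 - t ^ 2 / 4 - s ^ 2) / (2 * s))]

lemma sq_div_six_le_of_eq (hs : s ≠ 0)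
    (hW : W = t ^ 2 / 4 + (u ^ 2 + s ^ 2 + 1 - t ^ 2 / 4) ^ 2 / (4 * s ^ 2)) : s ^ 2 / 6 ≤ W := by
  have htW := sq_div_four_le_of_eq hW
  have hsq : (u ^ 2 + s ^ 2 + 1 - t ^ 2 / 4) ^ 2 ≤ 4 * s ^ 2 * W := by
    have : 4 * s ^ 2 * W = s ^ 2 * t ^ 2 + (u ^ 2 + s ^ 2 + 1 - t ^ 2 / 4) ^ 2 := by
      rw [hW]
      field_simp
    linarith [mul_nonneg (sq_nonneg s) (sq_nonneg t)]
  have hW0 : 0 ≤ W := htW.trans' (by positivity)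
  have hamgm : u ^ 2 + s ^ 2 + 1 - t ^ 2 / 4 ≤ s ^ 2 / 2 + 2 * W :=
    (abs_le_of_sq_le_sq' (hsq.trans (by linarith [sq_nonneg (s ^ 2 / 2 - 2 * W)]))
      (by positivity)).2
  linarith [sq_nonneg u]

lemma inv_pow_le_of_eq (hm : 3 ≤ m) (hs : s ≠ 0)
    (hW : W = t ^ 2 / 4 + (u ^ 2 + s ^ 2 + 1 - t ^ 2 / 4) ^ 2 / (4 * s ^ 2)) :
    (W ^ m)⁻¹ ≤ 90 / s ^ 2 * (1 / (1 + t ^ 2)) * (1 / (1 + m * u ^ 2)) := by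
  have hu := one_add_sq_le_of_eq hs hW
  have hW0 : 0 < W := hu.trans_lt' (by positivity)
  have ht : (1 + t ^ 2) / 5 ≤ W := by
    linarith [sq_div_four_le_of_eq hW, sq_nonneg u]
  obtain ⟨n, rfl⟩ := Nat.exists_eq_add_of_le' hm
  have hbernoulli : (1 + ((n + 3 : ℕ) : ℝ) * u ^ 2) / 3 ≤ W ^ (n + 1) := by
    refine le_trans ?_ ((one_add_mul_le_pow (by linarith [sq_nonneg u]) (n + 1)).trans
      (pow_le_pow_left₀ (by positivity) hu _))
    push_cast
    linarith [mul_nonneg n.cast_nonneg (sq_nonneg u)]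
  calc (W ^ (n + 3))⁻¹ = (W * W * W ^ (n + 1))⁻¹ := by ring
    _ ≤ (s ^ 2 / 6 * ((1 + t ^ 2) / 5) * ((1 + ((n + 3 : ℕ) : ℝ) * u ^ 2) / 3))⁻¹ := by
        gcongr
        exact sq_div_six_le_of_eq hs hW
    _ = _ := by
        field_simp
        norm_num

end RealEstimate

lemma inv_cosh_half_dist_smul_pow_le {m : ℕ} (hm : 3 ≤ m) (hc : γ 1 0 ≠ 0) :
    (cosh (dist z (γ • z) / 2) ^ (2 * m))⁻¹ ≤ 90 / (γ 1 0 * z.im) ^ 2 *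
      (1 / (1 + ((γ 0 0 + γ 1 1 : ℤ) : ℝ) ^ 2)) *
      (1 / (1 + m * (γ 1 0 * z.re - (γ 0 0 - γ 1 1 : ℤ) / 2) ^ 2)) := by
  rw [pow_mul]
  exact inv_pow_le_of_eq hm (mul_ne_zero (by exact_mod_cast hc) z.im_ne_zero)
    (cosh_half_dist_smul_sq_of_ne_zero z γ hc)

end HyperbolicDisplacement

section HorocycleAverage

open UpperHalfPlane Real Set

lemma lintegral_tsum_sub_intCast {φ : ℝ → ℝ≥0∞} (hφ : Measurable φ) :
    ∫⁻ x in Ioc (0 : ℝ) 1, ∑' n : ℤ, φ (x - n) = ∫⁻ x, φ x := by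
  have hsplit : ∫⁻ x, φ x = ∑' n : ℤ, ∫⁻ x in Ioc (n : ℝ) (n + 1), φ x := by
    rw [← lintegral_iUnion (fun _ => measurableSet_Ioc) (pairwise_disjoint_Ioc_intCast ℝ),
      iUnion_Ioc_intCast, setLIntegral_univ]
  rw [lintegral_tsum (f := fun (n : ℤ) x => φ (x - n)) fun n => (by fun_prop), hsplit,
    ← (Equiv.neg ℤ).tsum_eq]
  refine tsum_congr fun n => ?_
  rw [← lintegral_indicator measurableSet_Ioc, ← lintegral_indicator measurableSet_Ioc,
    ← lintegral_add_right_eq_self ((Ioc (n : ℝ) (n + 1)).indicator φ) (n : ℝ)]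
  refine lintegral_congr fun x => ?_
  simp only [indicator, mem_Ioc, Equiv.neg_apply, Int.cast_neg, sub_neg_eq_add]
  refine if_congr ⟨fun h => ⟨?_, ?_⟩, fun h => ⟨?_, ?_⟩⟩ rfl rfl <;> linarith [h.1, h.2]

lemma measurable_periodic_lift {G : ℝ → ℝ≥0∞} (hG : Measurable G) (hper : G.Periodic 1) :
    Measurable (hper.lift : UnitAddCircle → ℝ≥0∞) := by
  have hlift : (hper.lift : UnitAddCircle → ℝ≥0∞) =
      fun b => G (AddCircle.measurableEquivIoc 1 0 b) := by
    ext b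
    conv_lhs => rw [← AddCircle.coe_equivIoc (p := (1 : ℝ)) (a := 0) (y := b)]
    rw [Function.Periodic.lift_coe]
    rfl
  rw [hlift]
  exact hG.comp (measurable_subtype_coe.comp (AddCircle.measurableEquivIoc 1 0).measurable)

lemma setLIntegral_periodic_comp_intCast_mul_add {G : ℝ → ℝ≥0∞} (hG : Measurable G)
    (hper : G.Periodic 1) {c : ℤ} (hc : c ≠ 0) (h : ℝ) :
    ∫⁻ x in Ioc (0 : ℝ) 1, G (c * x + h) = ∫⁻ x in Ioc (0 : ℝ) 1, G x := by
  have hcircle (F : UnitAddCircle → ℝ≥0∞) :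
      ∫⁻ x in Ioc (0 : ℝ) 1, F x = ∫⁻ b : UnitAddCircle, F b := by
    simpa only [zero_add] using UnitAddCircle.lintegral_preimage 0 F
  have hmeas := measurable_periodic_lift hG hper
  calc ∫⁻ x in Ioc (0 : ℝ) 1, G (c * x + h)
      = ∫⁻ x in Ioc (0 : ℝ) 1, hper.lift (c • (x : UnitAddCircle) + (h : ℝ)) := by
        refine lintegral_congr fun x => ?_
        rw [← AddCircle.coe_zsmul, ← AddCircle.coe_add, zsmul_eq_mul, Function.Periodic.lift_coe]
    _ = ∫⁻ b : UnitAddCircle, hper.lift (c • b + (h : ℝ)) :=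
        hcircle fun b => hper.lift (c • b + (h : ℝ))
    _ = ∫⁻ b : UnitAddCircle, hper.lift (b + (h : ℝ)) :=
        (Measure.measurePreserving_zsmul volume hc).lintegral_comp
          (f := fun b => hper.lift (b + (h : ℝ))) (by fun_prop)
    _ = ∫⁻ b : UnitAddCircle, hper.lift b := lintegral_add_right_eq_self _ _
    _ = ∫⁻ x in Ioc (0 : ℝ) 1, G x := (hcircle hper.lift).symm

lemma tsum_setLIntegral_comp_intCast_mul_sub {φ : ℝ → ℝ≥0∞} (hφ : Measurable φ) {c : ℤ}
    (hc : c ≠ 0) (h : ℝ) :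
    ∑' a : ℤ, ∫⁻ x in Ioc (0 : ℝ) 1, φ (c * x - a + h) = ∫⁻ x, φ x := by
  have hper : Function.Periodic (fun v => ∑' a : ℤ, φ (v - a)) 1 := fun v => by
    beta_reduce
    rw [← (Equiv.addRight (1 : ℤ)).tsum_eq fun a : ℤ => φ (v + 1 - a)]
    simp only [Equiv.coe_addRight, Int.cast_add, Int.cast_one, add_sub_add_right_eq_sub]
  have hmeas (a : ℤ) : Measurable fun x : ℝ => φ (c * x - a + h) := by fun_prop
  rw [← lintegral_tsum fun a => (hmeas a).aemeasurable, ← lintegral_tsum_sub_intCast hφ,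
    ← setLIntegral_periodic_comp_intCast_mul_add (by fun_prop) hper hc h]
  simp_rw [sub_add_eq_add_sub]

lemma lintegral_ofReal_one_div_one_add_mul_sq {r : ℝ} (hr : 0 < r) :
    ∫⁻ x : ℝ, ENNReal.ofReal (1 / (1 + r * x ^ 2)) = ENNReal.ofReal (π / √r) := by
  have hsqrt : 0 < √r := sqrt_pos.mpr hr
  have hscale (x : ℝ) : 1 / (1 + r * x ^ 2) = (1 + (√r * x) ^ 2)⁻¹ := by
    rw [mul_pow, sq_sqrt hr.le, one_div]
  simp_rw [hscale]
  rw [← ofReal_integral_eq_lintegral_ofReal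
    (integrable_inv_one_add_sq.comp_mul_left' hsqrt.ne') (.of_forall fun x => by positivity),
    Measure.integral_comp_mul_left (fun x : ℝ => (1 + x ^ 2)⁻¹), integral_univ_inv_one_add_sq,
    abs_of_pos (inv_pos.mpr hsqrt), smul_eq_mul, inv_mul_eq_div]

lemma tsum_ofReal_one_div_sq_le : ∑' n : ℤ, ENNReal.ofReal (1 / (n : ℝ) ^ 2) ≤ 4 := by
  have hsum : HasSum (fun n : ℤ => 1 / (n : ℝ) ^ 2) (π ^ 2 / 6 + π ^ 2 / 6 - 1 / (0 : ℤ) ^ 2) :=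
    .of_nat_of_neg (by simpa using hasSum_zeta_two) (by simpa using hasSum_zeta_two)
  rw [← ENNReal.ofReal_tsum_of_nonneg (fun _ => by positivity) hsum.summable, hsum.tsum_eq,
    ← ENNReal.ofReal_ofNat]
  refine ENNReal.ofReal_le_ofReal ?_
  rw [Int.cast_zero, zero_pow two_ne_zero, div_zero, sub_zero]
  nlinarith [pi_pos, pi_lt_d2]

lemma tsum_ofReal_one_div_one_add_sq_le :
    ∑' n : ℤ, ENNReal.ofReal (1 / (1 + (n : ℝ) ^ 2)) ≤ 5 := by
  have hterm (n : ℤ) : ENNReal.ofReal (1 / (1 + (n : ℝ) ^ 2)) ≤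
      (if n = 0 then 1 else 0) + ENNReal.ofReal (1 / (n : ℝ) ^ 2) := by
    rcases eq_or_ne n 0 with rfl | hn
    · simp
    · rw [if_neg hn, zero_add]
      gcongr
      linarith
  calc _ ≤ _ := ENNReal.tsum_le_tsum hterm
    _ ≤ 1 + 4 := by
        rw [ENNReal.tsum_add, tsum_ite_eq]
        gcongr
        exact tsum_ofReal_one_div_sq_le
    _ = 5 := by norm_num

@[simp] lemma point_re {y : ℝ} (hy : 0 < y) (x : ℝ) : (point y hy x).re = x := by
  simp [point, UpperHalfPlane.re]

@[simp] lemma point_im {y : ℝ} (hy : 0 < y) (x : ℝ) : (point y hy x).im = y := by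
  simp [point, UpperHalfPlane.im]

/-- The absolute value of the term of `γ` in the Bergman kernel for weight `2 * m` at `(z, z)`,
normalized to be `1` for `γ = ±1`. -/
def kernelTerm (m : ℕ) (z : ℍ) (γ : SL(2, ℤ)) : ℝ≥0∞ :=
  ENNReal.ofReal (cosh (dist z (γ • z) / 2) ^ (2 * m))⁻¹

lemma kernelTerm_point_le {m : ℕ} (hm : 3 ≤ m) {y : ℝ} (hy : 0 < y) (x : ℝ) {γ : SL(2, ℤ)}
    (hc : γ 1 0 ≠ 0) :
    kernelTerm m (point y hy x) γ ≤
      ENNReal.ofReal (90 / y ^ 2) * (ENNReal.ofReal (1 / (γ 1 0 : ℝ) ^ 2) *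
        (ENNReal.ofReal (1 / (1 + ((γ 0 0 + γ 1 1 : ℤ) : ℝ) ^ 2)) *
          ENNReal.ofReal
            (1 / (1 + m * (γ 1 0 * x - γ 0 0 + ((γ 0 0 + γ 1 1 : ℤ) : ℝ) / 2) ^ 2)))) := by
  rw [← ENNReal.ofReal_mul (by positivity), ← ENNReal.ofReal_mul (by positivity),
    ← ENNReal.ofReal_mul (by positivity)]
  refine ENNReal.ofReal_le_ofReal
    ((inv_cosh_half_dist_smul_pow_le (point y hy x) γ hm hc).trans_eq ?_)
  rw [point_re, point_im, mul_pow]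
  push_cast
  ring

lemma injective_lowerLeft_trace_upperLeft :
    Function.Injective (fun γ : {γ : SL(2, ℤ) | γ 1 0 ≠ 0} =>
      ((γ.1 1 0, γ.1 0 0 + γ.1 1 1, γ.1 0 0) : ℤ × ℤ × ℤ)) := by
  rintro ⟨γ, hγ⟩ ⟨γ', hγ'⟩ h
  simp only [Prod.mk.injEq] at h
  obtain ⟨hc, htrace, ha⟩ := h
  have hd : γ 1 1 = γ' 1 1 := by linarith
  have hb : γ 0 1 = γ' 0 1 := by
    have hdet := det_eq_one γ
    rw [hc, ha, hd] at hdet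
    exact mul_right_cancel₀ hγ' (by linarith [det_eq_one γ'])
  ext i j
  fin_cases i <;> fin_cases j <;> assumption

lemma tsum_mul_setLIntegral_one_div_le {r : ℝ} (hr : 0 < r) :
    ∑' p : ℤ × ℤ × ℤ, ENNReal.ofReal (1 / (p.1 : ℝ) ^ 2) *
        (ENNReal.ofReal (1 / (1 + (p.2.1 : ℝ) ^ 2)) * ∫⁻ x in Ioc (0 : ℝ) 1,
          ENNReal.ofReal (1 / (1 + r * (p.1 * x - p.2.2 + (p.2.1 : ℝ) / 2) ^ 2))) ≤
      4 * (5 * ENNReal.ofReal (π / √r)) := by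
  let φ (u : ℝ) : ℝ≥0∞ := ENNReal.ofReal (1 / (1 + r * u ^ 2))
  have hφ : Measurable φ := by fun_prop
  have hinner (c : ℤ) : ENNReal.ofReal (1 / (c : ℝ) ^ 2) * ∑' t : ℤ,
      ENNReal.ofReal (1 / (1 + (t : ℝ) ^ 2)) *
        ∑' a : ℤ, ∫⁻ x in Ioc (0 : ℝ) 1, φ (c * x - a + (t : ℝ) / 2) =
      ENNReal.ofReal (1 / (c : ℝ) ^ 2) *
        ((∑' t : ℤ, ENNReal.ofReal (1 / (1 + (t : ℝ) ^ 2))) * ENNReal.ofReal (π / √r)) := by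
    rcases eq_or_ne c 0 with rfl | hc
    · simp
    · simp_rw [tsum_setLIntegral_comp_intCast_mul_sub hφ hc, φ,
        lintegral_ofReal_one_div_one_add_mul_sq hr, ENNReal.tsum_mul_right]
  simp_rw [ENNReal.tsum_prod', ENNReal.tsum_mul_left, φ] at hinner ⊢
  simp_rw [hinner, ENNReal.tsum_mul_right]
  gcongr
  exacts [tsum_ofReal_one_div_sq_le, tsum_ofReal_one_div_one_add_sq_le]

theorem lintegral_tsum_kernelTerm_lowerLeft_ne_zero_le {m : ℕ} (hm : 3 ≤ m) {y : ℝ} (hy : 0 < y) :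
    ∫⁻ x in Ioc (0 : ℝ) 1, ∑' γ : {γ : SL(2, ℤ) | γ 1 0 ≠ 0}, kernelTerm m (point y hy x) γ ≤
      ENNReal.ofReal (1800 * π / (y ^ 2 * √m)) := by
  let φ (u : ℝ) : ℝ≥0∞ := ENNReal.ofReal (1 / (1 + m * u ^ 2))
  let H (p : ℤ × ℤ × ℤ) : ℝ≥0∞ := ENNReal.ofReal (1 / (p.1 : ℝ) ^ 2) *
    (ENNReal.ofReal (1 / (1 + (p.2.1 : ℝ) ^ 2)) *
      ∫⁻ x in Ioc (0 : ℝ) 1, φ (p.1 * x - p.2.2 + (p.2.1 : ℝ) / 2))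
  calc _ ≤ ∫⁻ x in Ioc (0 : ℝ) 1, ∑' γ : {γ : SL(2, ℤ) | γ 1 0 ≠ 0},
        ENNReal.ofReal (90 / y ^ 2) * (ENNReal.ofReal (1 / (γ.1 1 0 : ℝ) ^ 2) *
        (ENNReal.ofReal (1 / (1 + ((γ.1 0 0 + γ.1 1 1 : ℤ) : ℝ) ^ 2)) *
          φ (γ.1 1 0 * x - γ.1 0 0 + ((γ.1 0 0 + γ.1 1 1 : ℤ) : ℝ) / 2))) :=
        lintegral_mono fun x => ENNReal.tsum_le_tsum fun γ => kernelTerm_point_le hm hy x γ.2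
    _ = ENNReal.ofReal (90 / y ^ 2) * ∑' γ : {γ : SL(2, ℤ) | γ 1 0 ≠ 0},
          H (γ.1 1 0, γ.1 0 0 + γ.1 1 1, γ.1 0 0) := by
        rw [lintegral_tsum fun γ => (by fun_prop), ← ENNReal.tsum_mul_left]
        refine tsum_congr fun γ => ?_
        rw [lintegral_const_mul _ (by fun_prop), lintegral_const_mul _ (by fun_prop),
          lintegral_const_mul _ (by fun_prop)]
    _ ≤ ENNReal.ofReal (90 / y ^ 2) * ∑' p, H p := by
        gcongr
        exact ENNReal.tsum_comp_le_tsum_of_injective injective_lowerLeft_trace_upperLeft H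
    _ ≤ ENNReal.ofReal (90 / y ^ 2) * (4 * (5 * ENNReal.ofReal (π / √m))) := by
        gcongr
        exact tsum_mul_setLIntegral_one_div_le (by positivity)
    _ = _ := by
        rw [← ENNReal.ofReal_ofNat 4, ← ENNReal.ofReal_ofNat 5,
          ← ENNReal.ofReal_mul (by positivity), ← ENNReal.ofReal_mul (by positivity),
          ← ENNReal.ofReal_mul (by positivity)]
        congr 1
        field_simp
        norm_num

section Unipotent

variable {γ : SL(2, ℤ)}

lemma one_le_upperRight_sq (hc : γ 1 0 = 0) (hone : γ ≠ 1) (hneg : γ ≠ -1) :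
    (1 : ℝ) ≤ (γ 0 1 : ℝ) ^ 2 := by
  have hb : γ 0 1 ≠ 0 := by
    intro hb
    rcases diag_eq_of_lowerLeft_eq_zero _ hc with ⟨ha, hd⟩ | ⟨ha, hd⟩
    · exact hone (by ext i j; fin_cases i <;> fin_cases j <;> simp [ha, hb, hc, hd])
    · exact hneg (by ext i j; fin_cases i <;> fin_cases j <;> simp [ha, hb, hc, hd])
  exact_mod_cast (show 0 < γ 0 1 ^ 2 by positivity)

lemma injective_decide_upperLeft_upperRight :
    Function.Injective (fun γ : {γ : SL(2, ℤ) | γ 1 0 = 0 ∧ γ ≠ 1 ∧ γ ≠ -1} =>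
      ((decide (γ.1 0 0 = 1), γ.1 0 1) : Bool × ℤ)) := by
  rintro ⟨γ, hγ, _⟩ ⟨γ', hγ', _⟩ h
  simp only [Prod.mk.injEq, decide_eq_decide] at h
  obtain ⟨hiff, hb⟩ := h
  have hdiag : γ 0 0 = γ' 0 0 ∧ γ 1 1 = γ' 1 1 := by
    rcases diag_eq_of_lowerLeft_eq_zero _ hγ with ⟨ha, hd⟩ | ⟨ha, hd⟩ <;>
    rcases diag_eq_of_lowerLeft_eq_zero _ hγ' with ⟨ha', hd'⟩ | ⟨ha', hd'⟩ <;> simp_all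
  ext i j
  fin_cases i <;> fin_cases j <;> simp [hb, hdiag, hγ, hγ']

lemma kernelTerm_succ_le (m : ℕ) (z : ℍ) (hc : γ 1 0 = 0) (hone : γ ≠ 1) (hneg : γ ≠ -1) :
    kernelTerm (m + 1) z γ ≤
      ENNReal.ofReal (4 * z.im ^ 2 * ((1 + 1 / (4 * z.im ^ 2)) ^ m)⁻¹) *
        ENNReal.ofReal (1 / (γ 0 1 : ℝ) ^ 2) := by
  have hb := one_le_upperRight_sq hc hone hneg
  have := z.im_pos
  have : 0 < (γ 0 1 : ℝ) ^ 2 := one_pos.trans_le hb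
  rw [kernelTerm, pow_mul, cosh_half_dist_smul_sq_of_eq_zero z γ hc,
    ← ENNReal.ofReal_mul (by positivity)]
  refine ENNReal.ofReal_le_ofReal ?_
  calc ((1 + (γ 0 1 : ℝ) ^ 2 / (4 * z.im ^ 2)) ^ (m + 1))⁻¹
      = ((1 + (γ 0 1 : ℝ) ^ 2 / (4 * z.im ^ 2)) ^ m)⁻¹ *
          (1 + (γ 0 1 : ℝ) ^ 2 / (4 * z.im ^ 2))⁻¹ := by rw [pow_succ, mul_inv]
    _ ≤ ((1 + 1 / (4 * z.im ^ 2)) ^ m)⁻¹ * ((γ 0 1 : ℝ) ^ 2 / (4 * z.im ^ 2))⁻¹ := by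
        gcongr
        exact le_add_of_nonneg_left zero_le_one
    _ = _ := by
        rw [inv_div]
        ring

theorem tsum_kernelTerm_unipotent_le (m : ℕ) (z : ℍ) :
    ∑' γ : {γ : SL(2, ℤ) | γ 1 0 = 0 ∧ γ ≠ 1 ∧ γ ≠ -1}, kernelTerm (m + 1) z γ ≤
      ENNReal.ofReal (32 * z.im ^ 2 * ((1 + 1 / (4 * z.im ^ 2)) ^ m)⁻¹) := by
  let ε : ℝ := 4 * z.im ^ 2 * ((1 + 1 / (4 * z.im ^ 2)) ^ m)⁻¹
  let H (p : Bool × ℤ) : ℝ≥0∞ := ENNReal.ofReal ε * ENNReal.ofReal (1 / (p.2 : ℝ) ^ 2)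
  calc _ ≤ ∑' γ : {γ : SL(2, ℤ) | γ 1 0 = 0 ∧ γ ≠ 1 ∧ γ ≠ -1},
        H (decide (γ.1 0 0 = 1), γ.1 0 1) :=
        ENNReal.tsum_le_tsum fun γ => kernelTerm_succ_le m z γ.2.1 γ.2.2.1 γ.2.2.2
    _ ≤ ∑' p, H p :=
        ENNReal.tsum_comp_le_tsum_of_injective injective_decide_upperLeft_upperRight H
    _ = 2 * (ENNReal.ofReal ε * ∑' n : ℤ, ENNReal.ofReal (1 / (n : ℝ) ^ 2)) := by
        rw [ENNReal.tsum_prod', tsum_bool]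
        simp only [H, ENNReal.tsum_mul_left, two_mul]
    _ ≤ 2 * (ENNReal.ofReal ε * 4) := by
        gcongr
        exact tsum_ofReal_one_div_sq_le
    _ = ENNReal.ofReal (2 * (ε * 4)) := by
        rw [ENNReal.ofReal_mul zero_le_two, ENNReal.ofReal_mul' zero_le_four,
          ENNReal.ofReal_ofNat, ENNReal.ofReal_ofNat]
    _ = _ := by
        congr 1
        ring

end Unipotent

end HorocycleAverage

section Dimension

lemma finrank_cuspForm_bounds {k : ℕ} (hk : 3 ≤ k) (hk2 : Even k) :
    k / 12 ≤ Module.finrank ℂ (CuspForm 𝒮ℒ (k : ℤ)) + 1 ∧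
      Module.finrank ℂ (CuspForm 𝒮ℒ (k : ℤ)) ≤ k / 12 := by
  have hrank := ModularForm.rank_eq_one_add_rank_cuspForm hk hk2
  rw [ModularForm.dimension_level_one k hk2] at hrank
  have hfinite : 1 + Module.rank ℂ (CuspForm 𝒮ℒ (k : ℤ)) < Cardinal.aleph0 :=
    hrank ▸ Cardinal.natCast_lt_aleph0
  obtain ⟨d, hd⟩ := Cardinal.lt_aleph0.mp (Cardinal.add_lt_aleph0_iff.mp hfinite).2
  rw [Module.finrank_eq_of_rank_eq hd]
  rw [hd] at hrank
  have hdim : (if k ≡ 2 [MOD 12] then k / 12 else k / 12 + 1) = 1 + d := by exact_mod_cast hrank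
  split_ifs at hdim <;> omega

lemma IsOrthonormalBasis.card_bounds {k : ℕ} (hk : 3 ≤ k) (hk2 : Even k)
    {B : Finset (CuspForm 𝒮ℒ (k : ℤ))} (hB : IsOrthonormalBasis B) :
    (k : ℝ) - 24 ≤ 12 * B.card ∧ 12 * (B.card : ℝ) ≤ k := by
  have hdim := finrank_cuspForm_bounds hk hk2
  rw [hB.finrank_eq_card] at hdim
  rw [sub_le_iff_le_add]
  exact ⟨by exact_mod_cast (by omega : k ≤ 12 * B.card + 24),
    by exact_mod_cast (by omega : 12 * B.card ≤ k)⟩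

end Dimension

section KernelDeviation

open UpperHalfPlane Set

variable {m : ℕ} (z : ℍ)

lemma pairing_one : pairing z 1 z = 2 * z.im * Complex.I := by
  rw [← coe_sub_conj]
  simp [pairing, pairingCoeff, sub_eq_add_neg]

lemma pairing_neg (γ : SL(2, ℤ)) (τ : ℂ) : pairing z (-γ) τ = -pairing z γ τ := by
  simp only [pairing, pairingCoeff, Matrix.SpecialLinearGroup.coe_neg, Matrix.neg_apply,
    Int.cast_neg]
  ring

lemma tsum_inv_pairing_div_pow_eq (hm : 3 ≤ m) :
    ∑' γ, ((pairing z γ z / (2 * z.im * Complex.I)) ^ (2 * m))⁻¹ =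
      2 + ∑' γ : ({1, -1}ᶜ : Set SL(2, ℤ)),
        ((pairing z γ z / (2 * z.im * Complex.I)) ^ (2 * m))⁻¹ := by
  let T (γ : SL(2, ℤ)) : ℂ := ((pairing z γ z / (2 * z.im * Complex.I)) ^ (2 * m))⁻¹
  have hI : (2 * z.im * Complex.I : ℂ) ≠ 0 := by simp [z.im_ne_zero]
  have hT : Summable T := by
    simp_rw [T, div_pow, inv_div, div_eq_mul_inv]
    exact (summable_inv_pairing_pow hm z z).mul_left _
  have hone : T 1 = 1 := by simp only [T, pairing_one, div_self hI, one_pow, inv_one]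
  have hneg : T (-1) = 1 := by
    simp only [T, pairing_neg, pairing_one, neg_div, div_self hI, (even_two_mul m).neg_one_pow,
      inv_one]
  have hsplit := hT.sum_add_tsum_compl (s := {1, -1})
  rw [Finset.sum_pair (ne_neg_self 1), hone, hneg, one_add_one_eq_two, Finset.coe_pair] at hsplit
  exact hsplit.symm

lemma enorm_inv_pairing_div_pow (γ : SL(2, ℤ)) :
    ‖((pairing z γ z / (2 * z.im * Complex.I)) ^ (2 * m))⁻¹‖ₑ = kernelTerm m z γ := by
  rw [← ofReal_norm, norm_inv, norm_pow, norm_pairing_div, kernelTerm]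

lemma tsum_kernelTerm_compl_le (m : ℕ) :
    ∑' γ : ({1, -1}ᶜ : Set SL(2, ℤ)), kernelTerm m z γ ≤
      ∑' γ : {γ : SL(2, ℤ) | γ 1 0 ≠ 0}, kernelTerm m z γ +
        ∑' γ : {γ : SL(2, ℤ) | γ 1 0 = 0 ∧ γ ≠ 1 ∧ γ ≠ -1}, kernelTerm m z γ := by
  refine (ENNReal.tsum_mono_subtype _ fun γ hγ => ?_).trans (ENNReal.tsum_union_le _ _ _)
  simp only [mem_compl_iff, mem_insert_iff, mem_singleton_iff, not_or] at hγ
  by_cases hc : γ 1 0 = 0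
  · exact .inr ⟨hc, hγ⟩
  · exact .inl hc

variable {B : Finset (CuspForm 𝒮ℒ ((2 * m : ℕ) : ℤ))}

theorem IsOrthonormalBasis.enorm_sum_sub_le (hB : IsOrthonormalBasis B) (hm : 3 ≤ m) :
    ‖∑ f ∈ B, z.im ^ (2 * m) * ‖f z‖ ^ 2 - ((2 * m : ℕ) - 1) / (4 * Real.pi)‖ₑ ≤
      ENNReal.ofReal (((2 * m : ℕ) - 1) / (8 * Real.pi)) *
        (∑' γ : {γ : SL(2, ℤ) | γ 1 0 ≠ 0}, kernelTerm m z γ +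
          ∑' γ : {γ : SL(2, ℤ) | γ 1 0 = 0 ∧ γ ≠ 1 ∧ γ ≠ -1}, kernelTerm m z γ) := by
  let R : ℂ := ∑' γ : ({1, -1}ᶜ : Set SL(2, ℤ)),
    ((pairing z γ z / (2 * z.im * Complex.I)) ^ (2 * m))⁻¹
  have hR : ‖R‖ₑ ≤ ∑' γ : ({1, -1}ᶜ : Set SL(2, ℤ)), kernelTerm m z γ := by
    refine enorm_tsum_le_tsum_enorm.trans_eq ?_
    simp_rw [enorm_inv_pairing_div_pow]
  have hkernel : ((∑ f ∈ B, z.im ^ (2 * m) * ‖f z‖ ^ 2 -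
      ((2 * m : ℕ) - 1) / (4 * Real.pi) : ℝ) : ℂ) =
        (((2 * m : ℕ) - 1) / (8 * Real.pi) : ℝ) * R := by
    rw [Complex.ofReal_sub, hB.sum_eq_tsum_pairing hm, tsum_inv_pairing_div_pow_eq z hm]
    push_cast
    ring
  have : (0 : ℝ) ≤ (2 * m : ℕ) - 1 := sub_nonneg.mpr (by exact_mod_cast (by omega : 1 ≤ 2 * m))
  rw [← ofReal_norm, ← Complex.norm_real, hkernel, norm_mul, Complex.norm_real,
    Real.norm_of_nonneg (by positivity), ENNReal.ofReal_mul (by positivity), ofReal_norm]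
  gcongr
  exact hR.trans (tsum_kernelTerm_compl_le z m)

end KernelDeviation

section Equidistribution

open UpperHalfPlane Set

variable {m : ℕ} {B : Finset (CuspForm 𝒮ℒ ((2 * m : ℕ) : ℤ))} {y : ℝ}

lemma enorm_main_term_sub_le {k N : ℝ} (hk : 36 ≤ k) (hlower : k - 24 ≤ 12 * N)
    (hupper : 12 * N ≤ k) :
    ‖(k - 1 - 12 * N) / (4 * Real.pi * N)‖ₑ ≤ ENNReal.ofReal (75 / k) := by
  have hN : k ≤ 36 * N := by linarith
  have : 0 < N := by linarith
  have hpi := Real.pi_gt_three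
  rw [← ofReal_norm]
  refine ENNReal.ofReal_le_ofReal ?_
  rw [Real.norm_eq_abs, abs_div, abs_of_pos (show 0 < 4 * Real.pi * N by positivity),
    div_le_div_iff₀ (by positivity) (by positivity)]
  have hnum : |k - 1 - 12 * N| ≤ 23 := abs_le.mpr ⟨by linarith, by linarith⟩
  calc |k - 1 - 12 * N| * k ≤ 23 * (36 * N) := by gcongr
    _ ≤ 75 * (4 * 3 * N) := by linarith
    _ ≤ 75 * (4 * Real.pi * N) := by gcongr

lemma IsOrthonormalBasis.enorm_density_sub_le (hB : IsOrthonormalBasis B) (hm : 18 ≤ m)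
    (hy : 0 < y) (x : ℝ) :
    ‖density B y hy x - 3 / Real.pi‖ₑ ≤
      2 * (∑' γ : {γ : SL(2, ℤ) | γ 1 0 ≠ 0}, kernelTerm m (point y hy x) γ +
          ∑' γ : {γ : SL(2, ℤ) | γ 1 0 = 0 ∧ γ ≠ 1 ∧ γ ≠ -1}, kernelTerm m (point y hy x) γ) +
        ENNReal.ofReal (75 / (2 * m : ℕ)) := by
  obtain ⟨hlower, hupper⟩ := hB.card_bounds (by lia) (even_two_mul m)
  have hkernel := hB.enorm_sum_sub_le (point y hy x) (by lia)
  rw [point_im] at hkernel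
  have hk : (36 : ℝ) ≤ (2 * m : ℕ) := by exact_mod_cast (by lia : 36 ≤ 2 * m)
  set k : ℝ := ((2 * m : ℕ) : ℝ)
  have hN : 0 < (B.card : ℝ) := by linarith
  have hpi := Real.pi_gt_three
  have hfactor : ENNReal.ofReal (B.card : ℝ)⁻¹ * ENNReal.ofReal ((k - 1) / (8 * Real.pi)) ≤ 2 := by
    rw [← ENNReal.ofReal_mul (by positivity), ← ENNReal.ofReal_ofNat]
    refine ENNReal.ofReal_le_ofReal ?_
    rw [inv_mul_le_iff₀ hN, div_le_iff₀ (by positivity)]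
    nlinarith
  have hsplit : density B y hy x - 3 / Real.pi = (B.card : ℝ)⁻¹ *
      (∑ f ∈ B, y ^ (2 * m) * ‖f (point y hy x)‖ ^ 2 - (k - 1) / (4 * Real.pi)) +
        (k - 1 - 12 * B.card) / (4 * Real.pi * B.card) := by
    rw [density]
    field_simp
    ring
  rw [hsplit]
  refine (enorm_add_le _ _).trans (add_le_add ?_ (enorm_main_term_sub_le hk hlower hupper))
  rw [enorm_mul, Real.enorm_of_nonneg (by positivity)]
  refine (mul_le_mul_right hkernel _).trans ?_
  rw [← mul_assoc]
  gcongr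

lemma mul_pi_div_sqrt_le (hm : 0 < m) (hy : 0 < y) :
    1800 * Real.pi / (y ^ 2 * √m) ≤ 12500 / (y ^ 2 * √(2 * m : ℕ)) := by
  have hsqrt : √(2 * m : ℕ) ≤ 2 * √m := by
    rw [Nat.cast_mul, Nat.cast_ofNat, Real.sqrt_mul zero_le_two]
    gcongr
    exact Real.sqrt_le_iff.mpr ⟨zero_le_two, by norm_num⟩
  have := Real.pi_lt_d2
  rw [div_le_div_iff₀ (by positivity) (by positivity)]
  calc 1800 * Real.pi * (y ^ 2 * √(2 * m : ℕ)) ≤ 1800 * 3.15 * (y ^ 2 * (2 * √m)) := by gcongr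
    _ ≤ 12500 * (y ^ 2 * √m) := by
        have : 0 ≤ y ^ 2 * √m := by positivity
        linarith

theorem IsOrthonormalBasis.lintegral_enorm_density_sub_le (hB : IsOrthonormalBasis B)
    (hm : 18 ≤ m) (hy : 0 < y) :
    ∫⁻ x in Ioc (0 : ℝ) 1, ‖density B y hy x - 3 / Real.pi‖ₑ ≤
      ENNReal.ofReal (25000 * (1 / (y ^ 2 * √(2 * m : ℕ)) + 1 / (2 * m : ℕ) +
        y ^ 2 * ((1 + 1 / (4 * y ^ 2)) ^ (m - 1))⁻¹)) := by
  obtain ⟨n, rfl⟩ : ∃ n, m = n + 1 := ⟨m - 1, by lia⟩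
  rw [Nat.add_sub_cancel]
  let δ : ℝ := ((1 + 1 / (4 * y ^ 2)) ^ n)⁻¹
  have hunipotent (x : ℝ) := tsum_kernelTerm_unipotent_le n (point y hy x)
  simp only [point_im] at hunipotent
  calc ∫⁻ x in Ioc (0 : ℝ) 1, ‖density B y hy x - 3 / Real.pi‖ₑ
      ≤ ∫⁻ x in Ioc (0 : ℝ) 1,
          (2 * (∑' γ : {γ : SL(2, ℤ) | γ 1 0 ≠ 0}, kernelTerm (n + 1) (point y hy x) γ +
            ENNReal.ofReal (32 * y ^ 2 * δ)) + ENNReal.ofReal (75 / (2 * (n + 1) : ℕ))) := by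
        refine lintegral_mono fun x => (hB.enorm_density_sub_le hm hy x).trans ?_
        gcongr
        exact hunipotent x
    _ = 2 * ((∫⁻ x in Ioc (0 : ℝ) 1,
          ∑' γ : {γ : SL(2, ℤ) | γ 1 0 ≠ 0}, kernelTerm (n + 1) (point y hy x) γ) +
            ENNReal.ofReal (32 * y ^ 2 * δ)) + ENNReal.ofReal (75 / (2 * (n + 1) : ℕ)) := by
        rw [lintegral_add_right _ measurable_const, lintegral_const_mul' _ _ ENNReal.ofNat_ne_top,
          lintegral_add_right _ measurable_const]
        simp
    _ ≤ 2 * (ENNReal.ofReal (12500 / (y ^ 2 * √(2 * (n + 1) : ℕ))) +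
          ENNReal.ofReal (32 * y ^ 2 * δ)) + ENNReal.ofReal (75 / (2 * (n + 1) : ℕ)) := by
        gcongr
        exact (lintegral_tsum_kernelTerm_lowerLeft_ne_zero_le (by lia) hy).trans
          (ENNReal.ofReal_le_ofReal (mul_pi_div_sqrt_le n.succ_pos hy))
    _ = ENNReal.ofReal (2 * (12500 / (y ^ 2 * √(2 * (n + 1) : ℕ)) + 32 * y ^ 2 * δ) +
          75 / (2 * (n + 1) : ℕ)) := by
        rw [ENNReal.ofReal_add (by positivity) (by positivity), ENNReal.ofReal_mul zero_le_two,
          ENNReal.ofReal_add (by positivity) (by positivity), ENNReal.ofReal_ofNat]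
    _ ≤ _ := by
        refine ENNReal.ofReal_le_ofReal ?_
        have : 0 ≤ y ^ 2 * δ := by positivity
        have : 0 ≤ 1 / ((2 * (n + 1) : ℕ) : ℝ) := by positivity
        rw [div_eq_mul_one_div 12500, div_eq_mul_one_div 75]
        linarith

end Equidistribution

section CircleDensity

open UpperHalfPlane Set

variable {k : ℕ} (B : Finset (CuspForm 𝒮ℒ (k : ℤ))) {y : ℝ} (hy : 0 < y)

lemma continuous_point : Continuous (point y hy) :=
  isEmbedding_coe.continuous_iff.mpr
    (by fun_prop : Continuous fun x : ℝ => (x : ℂ) + y * Complex.I)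

lemma continuous_density : Continuous (density B y hy) :=
  continuous_const.mul <| continuous_finsetSum _ fun f _ =>
    continuous_const.mul <| (f.holo'.continuous.comp (continuous_point hy)).norm.pow 2

lemma density_nonneg (x : ℝ) : 0 ≤ density B y hy x := by
  unfold density
  positivity

/-- The density of `horizontalMeasure` with respect to the Lebesgue measure on `ℝ / ℤ`. -/
def circleDensity (t : UnitAddCircle) : ℝ := (density_periodic B y hy).lift t

@[simp] lemma circleDensity_coe (x : ℝ) :
    circleDensity B hy (x : UnitAddCircle) = density B y hy x :=
  Function.Periodic.lift_coe _ x

lemma continuous_circleDensity : Continuous (circleDensity B hy) :=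
  continuous_coinduced_dom.mpr (continuous_density B hy)

lemma circleDensity_nonneg (t : UnitAddCircle) : 0 ≤ circleDensity B hy t := by
  induction t using QuotientAddGroup.induction_on with
  | H x => exact density_nonneg B hy x

lemma horizontalMeasure_eq_withDensity :
    horizontalMeasure B y hy =
      volume.withDensity fun t => ENNReal.ofReal (circleDensity B hy t) := rfl

lemma integrable_circleDensity_smul {ψ : UnitAddCircle → ℂ} (hψ : Integrable ψ) :
    Integrable fun t => circleDensity B hy t • ψ t := by
  obtain ⟨M, hM⟩ := isCompact_univ.exists_bound_of_continuousOn
    (continuous_circleDensity B hy).continuousOn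
  exact hψ.bdd_smul (φ := circleDensity B hy) M (continuous_circleDensity B hy).aestronglyMeasurable
    (.of_forall fun t => hM t (mem_univ t))

lemma integrable_horizontalMeasure {ψ : UnitAddCircle → ℂ} (hψ : Integrable ψ) :
    Integrable ψ (horizontalMeasure B y hy) := by
  rw [horizontalMeasure_eq_withDensity, integrable_withDensity_iff_integrable_smul'
    (continuous_circleDensity B hy).measurable.ennreal_ofReal (.of_forall fun _ => by simp)]
  simpa only [ENNReal.toReal_ofReal (circleDensity_nonneg B hy _)]
    using integrable_circleDensity_smul B hy hψ

lemma integral_horizontalMeasure (ψ : UnitAddCircle → ℂ) :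
    ∫ t, ψ t ∂(horizontalMeasure B y hy) = ∫ t, circleDensity B hy t • ψ t := by
  rw [horizontalMeasure_eq_withDensity, integral_withDensity_eq_integral_toReal_smul
    (continuous_circleDensity B hy).measurable.ennreal_ofReal (.of_forall fun _ => by simp)]
  simp only [ENNReal.toReal_ofReal (circleDensity_nonneg B hy _)]

theorem enorm_integral_horizontalMeasure_sub_le (c : ℝ) {ψ : UnitAddCircle → ℂ}
    (hψ : Integrable ψ) :
    ‖(∫ t, ψ t ∂(horizontalMeasure B y hy)) - (c : ℂ) * ∫ t, ψ t‖ₑ ≤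
      (∫⁻ x in Ioc (0 : ℝ) 1, ‖density B y hy x - c‖ₑ) * eLpNorm ψ ∞ volume := by
  have hcircle : ∫⁻ x in Ioc (0 : ℝ) 1, ‖density B y hy x - c‖ₑ =
      ∫⁻ t : UnitAddCircle, ‖circleDensity B hy t - c‖ₑ := by
    rw [← UnitAddCircle.lintegral_preimage 0, zero_add]
    simp only [circleDensity_coe]
  have hmeas : Measurable fun t : UnitAddCircle => ‖circleDensity B hy t - c‖ₑ :=
    ((continuous_circleDensity B hy).sub continuous_const).enorm.measurable
  rw [integral_horizontalMeasure, ← Complex.real_smul, ← integral_smul,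
    ← integral_sub (integrable_circleDensity_smul B hy hψ) (hψ.fun_smul c), hcircle,
    ← lintegral_mul_const _ hmeas, eLpNorm_exponent_top]
  refine (enorm_integral_le_lintegral_enorm _).trans (lintegral_mono_ae ?_)
  filter_upwards [ae_le_eLpNormEssSup (f := ψ) (μ := volume)] with t ht
  rw [← sub_smul, enorm_smul]
  gcongr

end CircleDensity

section ErrorTerm

variable {k : ℕ} {A Y y : ℝ}

lemma mul_sq_mul_log_le_of_lt_rpow (hA : 4 ≤ A) (hk : 2 ≤ k) (hy : 0 < y)
    (h : y < (k : ℝ) ^ (1 / 2 : ℝ) * (17 * A * Real.log k) ^ (-(1 / 2) : ℝ)) :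
    68 * y ^ 2 * Real.log k ≤ k := by
  have hlog : 0 < Real.log k := Real.log_pos (by exact_mod_cast hk)
  have hL : 0 < 17 * A * Real.log k := by positivity
  rw [Real.rpow_neg hL.le, ← Real.sqrt_eq_rpow, ← Real.sqrt_eq_rpow, ← div_eq_mul_inv,
    ← Real.sqrt_div k.cast_nonneg, Real.lt_sqrt hy.le, lt_div_iff₀ hL] at h
  calc 68 * y ^ 2 * Real.log k = y ^ 2 * (17 * 4 * Real.log k) := by ring
    _ ≤ y ^ 2 * (17 * A * Real.log k) := by gcongr
    _ ≤ k := h.le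

lemma one_le_log_of_three_le {x : ℝ} (hx : 3 ≤ x) : 1 ≤ Real.log x := by
  rw [Real.le_log_iff_exp_le (by positivity)]
  exact Real.exp_one_lt_three.le.trans hx

lemma seventeen_mul_log_le {x : ℝ} (hx : 34 ^ 2 ≤ x) : 17 * Real.log x ≤ x := by
  have hx0 : 0 ≤ x := by positivity
  calc 17 * Real.log x = 34 * Real.log √x := by
        rw [Real.log_sqrt hx0]
        ring
    _ ≤ √x * √x := by
        gcongr
        · exact Real.log_nonneg (Real.one_le_sqrt.mpr (by linarith))
        · exact Real.le_sqrt_of_sq_le hx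
        · exact Real.log_le_self (Real.sqrt_nonneg x)
    _ = x := Real.mul_self_sqrt hx0

lemma inv_one_add_log_div_pow_le {n : ℕ} (hk : 2000 ≤ k) (hn : k ≤ 4 * n) :
    ((1 + 17 * Real.log k / k) ^ n)⁻¹ ≤ ((k : ℝ) ^ 2)⁻¹ := by
  have : (0 : ℝ) < k := by exact_mod_cast (by lia : 0 < k)
  have hn' : (k : ℝ) / 4 ≤ n := by
    rw [div_le_iff₀' four_pos]
    exact_mod_cast hn
  have := Real.log_natCast_nonneg k
  set σ := 17 * Real.log k / k with hσ
  have hσ1 : σ ≤ 1 := div_le_one_of_le₀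
    (seventeen_mul_log_le (by exact_mod_cast (by lia : 34 ^ 2 ≤ k))) (by positivity)
  have hhalf : σ / 2 ≤ Real.log (1 + σ) :=
    calc σ / 2 ≤ σ / (1 + σ) := by
          gcongr
          linarith
      _ = 1 - (1 + σ)⁻¹ := by
          have : 1 + σ ≠ 0 := by positivity
          field_simp
          ring
      _ ≤ Real.log (1 + σ) := Real.one_sub_inv_le_log_of_pos (by positivity)
  have hmain : 2 * Real.log k ≤ n * Real.log (1 + σ) :=
    calc 2 * Real.log k ≤ 17 / 8 * Real.log k := by gcongr; norm_num
      _ = k / 4 * (σ / 2) := by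
          rw [hσ]
          field_simp
          ring
      _ ≤ n * Real.log (1 + σ) := by gcongr
  gcongr
  rw [← Real.log_le_log_iff (by positivity) (by positivity), Real.log_pow, Real.log_pow]
  exact_mod_cast hmain

lemma sq_mul_inv_one_add_pow_le (hk : 2000 ≤ k) (hy : 0 < y)
    (hyk : 68 * y ^ 2 * Real.log k ≤ k) :
    y ^ 2 * ((1 + 1 / (4 * y ^ 2)) ^ (k / 2 - 1))⁻¹ ≤ 1 / k := by
  have hk0 : (0 : ℝ) < k := by exact_mod_cast (by lia : 0 < k)
  have hlog : 1 ≤ Real.log k := one_le_log_of_three_le (by exact_mod_cast (by lia : 3 ≤ k))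
  have hsq : y ^ 2 ≤ k := by nlinarith
  have hσ : 17 * Real.log k / k ≤ 1 / (4 * y ^ 2) := by
    rw [div_le_div_iff₀ hk0 (by positivity)]
    linarith
  calc y ^ 2 * ((1 + 1 / (4 * y ^ 2)) ^ (k / 2 - 1))⁻¹
      ≤ k * ((1 + 17 * Real.log k / k) ^ (k / 2 - 1))⁻¹ := by gcongr
    _ ≤ k * ((k : ℝ) ^ 2)⁻¹ :=
        mul_le_mul_of_nonneg_left (inv_one_add_log_div_pow_le hk (by lia)) hk0.le
    _ = 1 / k := by field_simp

lemma error_le (hA : 4 ≤ A) (hY : 1 ≤ Y) (hk : 2000 ≤ k) (hy : 0 < y) (hYy : Y⁻¹ < y)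
    (hyk : y < (k : ℝ) ^ (1 / 2 : ℝ) * (17 * A * Real.log k) ^ (-(1 / 2) : ℝ)) :
    25000 * (1 / (y ^ 2 * √k) + 1 / k + y ^ 2 * ((1 + 1 / (4 * y ^ 2)) ^ (k / 2 - 1))⁻¹) ≤
      75000 * Y ^ 2 * (k : ℝ) ^ (-(1 / 2) : ℝ) * Real.log k ^ (1 / 2 : ℝ) := by
  have hk1 : (1 : ℝ) ≤ k := by exact_mod_cast (by lia : 1 ≤ k)
  have hlog : 1 ≤ Real.log k := one_le_log_of_three_le (by exact_mod_cast (by lia : 3 ≤ k))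
  have hcusp : 1 / (y ^ 2 * √k) ≤ Y ^ 2 * (√k)⁻¹ := by
    rw [one_div, mul_inv, ← inv_pow]
    have : y⁻¹ ≤ Y := inv_le_of_inv_le₀ (by positivity) hYy.le
    gcongr
  have hinv : 1 / (k : ℝ) ≤ Y ^ 2 * (√k)⁻¹ := by
    rw [one_div]
    calc (k : ℝ)⁻¹ ≤ (√k)⁻¹ := by
          gcongr
          exact Real.sqrt_le_self_iff.mpr (.inr hk1)
      _ ≤ Y ^ 2 * (√k)⁻¹ := le_mul_of_one_le_left (by positivity) (one_le_pow₀ hY)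
  have hunipotent := sq_mul_inv_one_add_pow_le hk hy
    (mul_sq_mul_log_le_of_lt_rpow hA (by lia) hy hyk)
  rw [Real.rpow_neg k.cast_nonneg, ← Real.sqrt_eq_rpow]
  calc _ ≤ 75000 * Y ^ 2 * (√k)⁻¹ := by linarith
    _ ≤ _ := le_mul_of_one_le_right (by positivity) (Real.one_le_rpow hlog (by norm_num))

end ErrorTerm

end ModularAverage

end

theorem theorem2_general {k : ℕ} (hk : 36 ≤ k) (hk2 : Even k)
    {B : Finset (CuspForm 𝒮ℒ (k : ℤ))} (hB : ModularAverage.IsOrthonormalBasis B)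
    {y : ℝ} (hy : 0 < y) {ψ : UnitAddCircle → ℂ} (hψ : Integrable ψ volume) :
    Integrable ψ (ModularAverage.horizontalMeasure B y hy) ∧
      ‖(∫ x, ψ x ∂(ModularAverage.horizontalMeasure B y hy))
          - ((3 / Real.pi : ℝ) : ℂ) * ∫ x, ψ x‖ₑ ≤
        ENNReal.ofReal (25000 * (1 / (y ^ 2 * √k) + 1 / k +
            y ^ 2 * ((1 + 1 / (4 * y ^ 2)) ^ (k / 2 - 1))⁻¹))
          * eLpNorm ψ ∞ volume := by
  obtain ⟨m, rfl⟩ := hk2.exists_two_nsmul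
  refine ⟨ModularAverage.integrable_horizontalMeasure B hy hψ,
    (ModularAverage.enorm_integral_horizontalMeasure_sub_le B hy _ hψ).trans ?_⟩
  gcongr
  simpa using hB.lintegral_enorm_density_sub_le (by lia) hy

/-- The four constants are absolute. The norm `‖ψ‖_∞` is the essential supremum, which may be
infinite. -/
theorem theorem2 :
    ∃ A₀ Y₀ C : ℝ, ∃ k₀ : ℕ, 0 < A₀ ∧ 0 < Y₀ ∧ 0 < C ∧ 2 ≤ k₀ ∧
      ∀ A : ℝ, A₀ ≤ A → ∀ Y : ℝ, Y₀ ≤ Y → ∀ k : ℕ, k₀ ≤ k → Even k →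
      ∀ B : Finset (CuspForm 𝒮ℒ (k : ℤ)), ModularAverage.IsOrthonormalBasis B →
      ∀ (y : ℝ) (hy : 0 < y), Y⁻¹ < y →
        y < (k : ℝ) ^ (1 / 2 : ℝ) * (17 * A * Real.log k) ^ (-(1 / 2) : ℝ) →
      ∀ ψ : UnitAddCircle → ℂ, Integrable ψ volume →
        Integrable ψ (ModularAverage.horizontalMeasure B y hy) ∧
        ‖(∫ x, ψ x ∂(ModularAverage.horizontalMeasure B y hy))
            - ((3 / Real.pi : ℝ) : ℂ) * ∫ x, ψ x‖ₑ ≤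
          ENNReal.ofReal
              (C * Y ^ 2 * (k : ℝ) ^ (-(1 / 2) : ℝ) * (Real.log k) ^ (1 / 2 : ℝ))
            * eLpNorm ψ ∞ volume := by
  refine ⟨4, 1, 75000, 2000, by norm_num, by norm_num, by norm_num, by norm_num, ?_⟩
  intro A hA Y hY k hk hk2 B hB y hy hYy hyk ψ hψ
  exact (theorem2_general (by lia) hk2 hB hy hψ).imp_right fun h => h.trans <|
    mul_le_mul_left (ENNReal.ofReal_le_ofReal (ModularAverage.error_le hA hY hk hy hYy hyk)) _
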